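/- Let $n_R,n_T,K\ge 0$ be integers, $N_0>0$, and let $\mathbf H\in\mathbb C^{n_R\times n_T}$ be arbitrary. Consider $\mathbf y=\mathbf H\mathbf x+\mathbf n$, where $\mathbf x\sim\mathcal{CN}(\mathbf 0,\mathbf I_{n_T})$ and $\mathbf n\sim\mathcal{CN}(\mathbf 0,N_0\mathbf I_{n_R})$ are independent circularly-symmetric complex Gaussian vectors, and let $p_{\mathbf X}$ be the density of $\mathbf x$. For an $n_T\times n_R$ complex matrix $\mathbf H_r$ and a Hermitian $n_T\times n_T$ matrix $\mathbf G_r$ whose entries are zero off the center $2K+1$ diagonals put $$\tilde T(\mathbf y|\mathbf x)=\exp\left(2\,\mathrm{Re}\{\mathbf x^{\mathrm H}\mathbf H_r\mathbf y\}-\mathbf x^{\mathrm H}\mathbf G_r\mathbf x\right),\qquad \tilde T(\mathbf y)=\int\tilde T(\mathbf y|\mathbf x)\,p_{\mathbf X}(\mathbf x)\,d\mathbf x\in(0,\infty],$$ $$I_{\mathrm{GMI}}(\mathbf H_r,\mathbf G_r)=-\mathbb E[\log\tilde T(\mathbf y)]+\mathbb E[\log\tilde T(\mathbf y|\mathbf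 x)]\in[-\infty,\infty)$$ (generalized mutual information in nats). For every such $\mathbf G_r$ let $\mathbf H_r^{\mathrm{opt}}=\mathbf H_r^{\mathrm{opt}}(\mathbf G_r)$ be a maximizer of $I_{\mathrm{GMI}}(\cdot,\mathbf G_r)$ over all $n_T\times n_R$ matrices, and let $\mathbf G_r^{\mathrm{opt}}$ be a maximizer of $\mathbf G_r\mapsto I_{\mathrm{GMI}}(\mathbf H_r^{\mathrm{opt}}(\mathbf G_r),\mathbf G_r)$ over all such $\mathbf G_r$. Let $\mathbf G=\mathbf H^{\mathrm H}\mathbf H$ and let $\mathbf G_{[k,n]}=\bar{\mathbf H}_{[k,n]}^{\mathrm H}\bar{\mathbf H}_{[k,n]}$, where $\bar{\mathbf H}_{[k,n]}$ is $\mathbf H$ with columns $k,k+1,\dots,n$ removed, and $\mathbf G_{[k,n]}=\mathbf G$ if $n<k$. Then maximizers exist, and for every choice of them $$I_{\mathrm{GMI}}(\mathbf H_r^{\mathrm{opt}},\mathbf G_r^{\mathrm{opt}})=\log\det\left(\mathbf I+\frac{\mathbf G}{N_0}\right)-\sum_{k=1}^{n_T-K}\log\det\left(\mathbf I+\frac{\mathbf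 G_{[k,k+K]}}{N_0}\right)+\sum_{k=2}^{n_T-K}\log\det\left(\mathbf I+\frac{\mathbf G_{[k,k+K-1]}}{N_0}\right),$$ where each $\mathbf I$ is the identity matrix of matching size, an empty sum is $0$ and the determinant of an empty matrix is $1$. In particular, for $K=0$ this is the MMSE rate formula $$I_{\mathrm{GMI}}(\mathbf H_r^{\mathrm{opt}},\mathbf G_r^{\mathrm{opt}})=n_T\log\det\left(\mathbf I+\frac{\mathbf G}{N_0}\right)-\sum_{k=1}^{n_T}\log\det\left(\mathbf I+\frac{\mathbf G_{[k,k]}}{N_0}\right).$$ -/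

import Mathlib

open MeasureTheory
open scoped ENNReal Matrix

noncomputable section

namespace ChannelShortening

/-- Density, with respect to Lebesgue measure on `ℂⁿ`, of the zero-mean circularly-symmetric
complex Gaussian vector with covariance `s • I` (for `s > 0`). -/
def cscgPDF (n : ℕ) (s : ℝ) (x : Fin n → ℂ) : ℝ :=
  ((Real.pi * s) ^ n)⁻¹ * Real.exp (-(∑ i, ‖x i‖ ^ 2) / s)

/-- The law `CN(0, s • I)` on `ℂⁿ`. -/
def cscg (n : ℕ) (s : ℝ) : Measure (Fin n → ℂ) :=
  volume.withDensity fun x => ENNReal.ofReal (cscgPDF n s x)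

/-- Joint law of the independent pair (input `x ∼ CN(0, I)`, noise `w ∼ CN(0, N₀ I)`). -/
def inputNoiseLaw (nT nR : ℕ) (N₀ : ℝ) : Measure ((Fin nT → ℂ) × (Fin nR → ℂ)) :=
  (cscg nT 1).prod (cscg nR N₀)

/-- The received vector `y = H x + w`. -/
def received {nR nT : ℕ} (H : Matrix (Fin nR) (Fin nT) ℂ)
    (p : (Fin nT → ℂ) × (Fin nR → ℂ)) : Fin nR → ℂ :=
  H *ᵥ p.1 + p.2

/-- Expectation of an extended-real random variable: positive part minus negative part. -/
def expect {Ω : Type*} [MeasurableSpace Ω] (μ : Measure Ω) (f : Ω → EReal) : EReal :=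
  ((∫⁻ ω, (f ω).toENNReal ∂μ : ℝ≥0∞) : EReal) - ((∫⁻ ω, (-f ω).toENNReal ∂μ : ℝ≥0∞) : EReal)

variable {nR nT : ℕ}

/-- The mismatched receiver function
`T(y|x) = exp (2 Re (xᴴ Hr y) - xᴴ Gr x)`; the quadratic form is real when `Gr` is Hermitian. -/
def receiverFun (Hr : Matrix (Fin nT) (Fin nR) ℂ) (Gr : Matrix (Fin nT) (Fin nT) ℂ)
    (y : Fin nR → ℂ) (x : Fin nT → ℂ) : ℝ :=
  Real.exp (2 * (star x ⬝ᵥ (Hr *ᵥ y)).re - (star x ⬝ᵥ (Gr *ᵥ x)).re)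

/-- `T(y) = ∫ T(y|x) p_X(x) dx`, which may be infinite. -/
def receiverMarginal (Hr : Matrix (Fin nT) (Fin nR) ℂ) (Gr : Matrix (Fin nT) (Fin nT) ℂ)
    (y : Fin nR → ℂ) : ℝ≥0∞ :=
  ∫⁻ x : Fin nT → ℂ, ENNReal.ofReal (receiverFun Hr Gr y x * cscgPDF nT 1 x)

/-- The generalized mutual information `-E[log T(Y)] + E[log T(Y|X)]` in nats. It is `⊥` when
`E[log T(Y)] = ⊤`. -/
def GMI (H : Matrix (Fin nR) (Fin nT) ℂ) (N₀ : ℝ)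
    (Hr : Matrix (Fin nT) (Fin nR) ℂ) (Gr : Matrix (Fin nT) (Fin nT) ℂ) : EReal :=
  -expect (inputNoiseLaw nT nR N₀)
      (fun p => ENNReal.log (receiverMarginal Hr Gr (received H p)))
    + expect (inputNoiseLaw nT nR N₀)
      (fun p => ENNReal.log (ENNReal.ofReal (receiverFun Hr Gr (received H p) p.1)))

/-- The admissible `Gr` for memory `K`: Hermitian matrices that vanish off the center `2K+1`
diagonals. -/
def bandHermitian (nT K : ℕ) : Set (Matrix (Fin nT) (Fin nT) ℂ) :=
  {Gr | Gr.IsHermitian ∧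
    ∀ i j : Fin nT, ((i : ℕ) + K < j ∨ (j : ℕ) + K < i) → Gr i j = 0}

/-- `Hopt` assigns to each admissible `Gr` a maximizer of `Hr ↦ GMI(Hr, Gr)` over all matrices,
and `Gopt` is a maximizer of `Gr ↦ GMI(Hopt Gr, Gr)` over the admissible `Gr`. -/
structure IsOptimalReceiver (H : Matrix (Fin nR) (Fin nT) ℂ) (N₀ : ℝ) (K : ℕ)
    (Hopt : Matrix (Fin nT) (Fin nT) ℂ → Matrix (Fin nT) (Fin nR) ℂ)
    (Gopt : Matrix (Fin nT) (Fin nT) ℂ) : Prop where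
  front : ∀ Gr ∈ bandHermitian nT K, IsMaxOn (fun Hr => GMI H N₀ Hr Gr) Set.univ (Hopt Gr)
  mem : Gopt ∈ bandHermitian nT K
  gram : IsMaxOn (fun Gr => GMI H N₀ (Hopt Gr) Gr) (bandHermitian nT K) Gopt

/-- `H` with the columns number `k, …, n` (counted from `1`) removed; `H` itself if `n < k`. -/
def removeCols (H : Matrix (Fin nR) (Fin nT) ℂ) (k n : ℕ) :
    Matrix (Fin nR) {j : Fin nT // ¬(k ≤ (j : ℕ) + 1 ∧ (j : ℕ) + 1 ≤ n)} ℂ :=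
  H.submatrix id Subtype.val

/-- `log det (I + AᴴA / N₀)`; the determinant is a positive real number when `N₀ > 0`. -/
def logDetGram {ι : Type*} [Fintype ι] [DecidableEq ι] (A : Matrix (Fin nR) ι ℂ) (N₀ : ℝ) : ℝ :=
  Real.log (1 + (N₀ : ℂ)⁻¹ • (Aᴴ * A)).det.re

end ChannelShortening

end

/-! Put `M = 1 + Gr`, `R = H Hᴴ + N₀` and `B = (1 + Hᴴ H / N₀)⁻¹`, the MMSE error covariance. The
Gaussian prior contributes the `1` in `M`, so the marginal is a Gaussian integral of the form `M`.
If `M` is not positive definite it is infinite and the rate is `⊥`. Otherwise the rate depends only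
on second moments and is a concave quadratic in `Hr`; completing the square
(`front_complete_square`) gives the maximizer `M Hᴴ R⁻¹` and the value `log det M - tr (M B) + nT`.

It remains to maximize this over banded positive definite `M`. The trace sees only the entries of
`B` on the band. A banded triangular factor `C` is built from `B`, one window `{i, …, i+K}` per row,
so that `(Cᴴ C)⁻¹` agrees with `B` on the band (`band_inv_eq`). Hence `tr (M B) = tr ((Cᴴ C)⁻¹ M)`
for all banded `M`, and concavity of `log det` makes `Cᴴ C` optimal. There the trace is `nT`, and
`log det` is a sum of logarithms of ratios of window minors of `B`.

Jacobi's identity converts a minor of `B` into the determinant of `1 + Hᴴ H / N₀` with the window's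
columns removed, divided by the full determinant. The windows cut off by the last index telescope,
leaving the stated sums. Uniqueness of maximizers is not needed: any two optimal receivers dominate
each other. -/

namespace ChannelShortening

open scoped ComplexOrder

/-! ### Minors of inverse matrices and concavity of `log det` -/

section LinearAlgebra

variable {ι : Type*} [Fintype ι] [DecidableEq ι]

/-- Jacobi's identity for a principal minor of the inverse matrix. -/
theorem det_mul_det_inv_submatrix (A : Matrix ι ι ℂ) (hA : IsUnit A.det) (p : ι → Prop)
    [DecidablePred p] :
    A.det * (A⁻¹.submatrix (Subtype.val : {i // p i} → ι) Subtype.val).det =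
      (A.submatrix (Subtype.val : {i // ¬ p i} → ι) Subtype.val).det := by
  set e := Equiv.sumCompl p
  set A' := A.submatrix e e with hA'
  set X := A⁻¹.submatrix e e with hX
  have h1 : A' * X = 1 := by
    rw [hA', hX, Matrix.submatrix_mul_equiv, Matrix.mul_nonsing_inv _ hA,
      Matrix.submatrix_one_equiv]
  rw [← Matrix.fromBlocks_toBlocks A', ← Matrix.fromBlocks_toBlocks X, Matrix.fromBlocks_multiply,
    ← Matrix.fromBlocks_one, Matrix.fromBlocks_inj] at h1
  obtain ⟨h11, -, h21, -⟩ := h1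
  -- Keeping only the first block column of the inverse makes both the right factor and the product
  -- block triangular, so determinants give the identity without inverting any block.
  have h2 : A' * Matrix.fromBlocks X.toBlocks₁₁ 0 X.toBlocks₂₁ 1 =
      Matrix.fromBlocks 1 A'.toBlocks₁₂ 0 A'.toBlocks₂₂ := by
    conv_lhs => rw [← Matrix.fromBlocks_toBlocks A', Matrix.fromBlocks_multiply, h11, h21]
    simp
  have h3 := congrArg Matrix.det h2
  rw [Matrix.det_mul, Matrix.det_fromBlocks_zero₁₂, Matrix.det_fromBlocks_zero₂₁, Matrix.det_one,
    Matrix.det_one, one_mul, mul_one, hA', Matrix.det_submatrix_equiv_self] at h3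
  exact h3

theorem det_mul_inv_diag (A : Matrix ι ι ℂ) (hA : IsUnit A.det) (i : ι) :
    A.det * A⁻¹ i i = (A.submatrix (Subtype.val : {j // ¬ j = i} → ι) Subtype.val).det := by
  refine Eq.trans ?_ (det_mul_det_inv_submatrix A hA fun j => j = i)
  congr 1
  have k : {j // j = i} := ⟨i, rfl⟩
  convert (Matrix.det_eq_elem_of_subsingleton
    (A⁻¹.submatrix (Subtype.val : {j // j = i} → ι) Subtype.val) k).symm using 1
  · rw [Matrix.submatrix_apply, k.2]
  · congr!

/-- The column of the inverse of a principal submatrix, extended by zero. -/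
theorem exists_window_solution (B : Matrix ι ι ℂ) (p : ι → Prop) [DecidablePred p]
    (hB : IsUnit (B.submatrix (Subtype.val : {i // p i} → ι) Subtype.val).det) (i : ι) (hi : p i) :
    ∃ v : ι → ℂ, (∀ j, ¬ p j → v j = 0) ∧
      (∀ j, p j → (B *ᵥ v) j = if j = i then 1 else 0) ∧
      (B.submatrix (Subtype.val : {j // p j} → ι) Subtype.val).det * v i =
        (B.submatrix (Subtype.val : {j // p j ∧ j ≠ i} → ι) Subtype.val).det := by
  set S := B.submatrix (Subtype.val : {i // p i} → ι) Subtype.val with hS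
  refine ⟨fun j => if h : p j then S⁻¹ ⟨j, h⟩ ⟨i, hi⟩ else 0, fun j hj => by simp [hj], ?_, ?_⟩
  · intro j hj
    have h1 := congrFun (congrFun (Matrix.mul_nonsing_inv S hB) ⟨j, hj⟩) ⟨i, hi⟩
    rw [Matrix.mul_apply, Matrix.one_apply] at h1
    simp only [Subtype.mk.injEq] at h1
    rw [← h1, Matrix.mulVec, dotProduct, ← Fintype.sum_subtype_add_sum_subtype p]
    rw [Finset.sum_eq_zero (s := (Finset.univ : Finset {x // ¬ p x})), add_zero]
    · refine Finset.sum_congr rfl fun k _ => ?_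
      simp [hS, k.2]
    · intro k _
      simp [k.2]
  · have h2 := det_mul_inv_diag S hB ⟨i, hi⟩
    simp only [hi, dite_true]
    rw [h2]
    let e : {j // p j ∧ j ≠ i} ≃ {j : {i // p i} // ¬ j = ⟨i, hi⟩} :=
      { toFun := fun j => ⟨⟨j.1, j.2.1⟩, fun h => j.2.2 (congrArg Subtype.val h)⟩
        invFun := fun j => ⟨j.1.1, j.1.2, fun h => j.2 (Subtype.ext h)⟩
        left_inv := fun _ => rfl
        right_inv := fun _ => rfl }
    rw [← Matrix.det_submatrix_equiv_self e]
    rfl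

/-- This is `log t ≤ t - 1` summed over the eigenvalues. -/
theorem log_det_le_trace_sub_card {N : Matrix ι ι ℂ} (hN : N.PosDef) :
    Real.log N.det.re ≤ N.trace.re - Fintype.card ι := by
  rw [hN.1.det_eq_prod_eigenvalues, hN.1.trace_eq_sum_eigenvalues]
  have h1 : (∏ i, ((hN.1.eigenvalues i : ℝ) : ℂ)) = ((∏ i, hN.1.eigenvalues i : ℝ) : ℂ) := by
    push_cast; rfl
  have h2 : (∑ i, ((hN.1.eigenvalues i : ℝ) : ℂ)) = ((∑ i, hN.1.eigenvalues i : ℝ) : ℂ) := by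
    push_cast; rfl
  have e1 : (∏ i, hN.1.eigenvalues i) = (∏ i, ((hN.1.eigenvalues i : ℝ) : ℂ)).re := by
    rw [h1, Complex.ofReal_re]
  have e2 : (∑ i, hN.1.eigenvalues i) = (∑ i, ((hN.1.eigenvalues i : ℝ) : ℂ)).re := by
    rw [h2, Complex.ofReal_re]
  refine (congrArg Real.log e1).symm.le.trans ?_
  refine le_trans ?_ (congrArg (· - (Fintype.card ι : ℝ)) e2).le
  rw [Real.log_prod (fun i _ => (hN.eigenvalues_pos i).ne')]
  calc _ ≤ ∑ i, (hN.1.eigenvalues i - 1) :=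
        Finset.sum_le_sum fun i _ => Real.log_le_sub_one_of_pos (hN.eigenvalues_pos i)
    _ = _ := by simp

theorem posDef_det_eq_re {N : Matrix ι ι ℂ} (hN : N.PosDef) :
    N.det = (N.det.re : ℂ) ∧ 0 < N.det.re := by
  have h := Complex.pos_iff.1 hN.det_pos
  exact ⟨Complex.ext rfl (by simp [h.2]), h.1⟩

/-- Concavity of `log det`, at the matrix `Cᴴ C`. -/
theorem log_det_le_of_factor {M C : Matrix ι ι ℂ} (hM : M.PosDef) (hC : IsUnit C.det) :
    Real.log M.det.re ≤
      Real.log (Cᴴ * C).det.re + (((Cᴴ * C)⁻¹ * M).trace.re - Fintype.card ι) := by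
  have hCu : IsUnit C := (Matrix.isUnit_iff_isUnit_det _).2 hC
  have hinj : Function.Injective C.mulVec := Matrix.mulVec_injective_of_isUnit hCu
  have hP : (Cᴴ * C).PosDef := Matrix.PosDef.conjTranspose_mul_self C hinj
  have hCi : IsUnit C⁻¹ := (Matrix.isUnit_nonsing_inv_iff).2 hCu
  -- Congruence by `C⁻¹` moves the base point `Cᴴ C` to the identity, where the eigenvalue bound
  -- applies.
  set N := (C⁻¹)ᴴ * M * C⁻¹ with hNdef
  have hN : N.PosDef := hM.conjTranspose_mul_mul_same (Matrix.mulVec_injective_of_isUnit hCi)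
  have hdet : (Cᴴ * C).det * N.det = M.det := by
    rw [hNdef]
    simp only [Matrix.det_mul, Matrix.det_conjTranspose, Matrix.det_nonsing_inv]
    have : C.det * Ring.inverse C.det = 1 := Ring.mul_inverse_cancel _ hC
    have h' : star C.det * star (Ring.inverse C.det) = 1 := by
      rw [← star_mul', this, star_one]
    linear_combination (M.det * C.det * Ring.inverse C.det) * h' + M.det * this
  have htr : N.trace = ((Cᴴ * C)⁻¹ * M).trace := by
    rw [hNdef, Matrix.trace_mul_comm, ← Matrix.mul_assoc, Matrix.mul_inv_rev,
      Matrix.conjTranspose_nonsing_inv]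
  obtain ⟨e1, p1⟩ := posDef_det_eq_re hP
  obtain ⟨e2, p2⟩ := posDef_det_eq_re hN
  have : M.det.re = (Cᴴ * C).det.re * N.det.re := by
    rw [← hdet, e1, e2, ← Complex.ofReal_mul, Complex.ofReal_re]
    simp
  rw [this, Real.log_mul p1.ne' p2.ne', ← htr]
  linarith [log_det_le_trace_sub_card hN]

end LinearAlgebra

/-! ### Banded factor and the banded determinant maximization -/

section Band

variable {n : ℕ}

/-- The index window `{i, …, i + K}`. -/
def InWindow (K : ℕ) (i j : Fin n) : Prop := (i : ℕ) ≤ j ∧ (j : ℕ) ≤ i + K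

instance (K : ℕ) (i : Fin n) : DecidablePred (InWindow K i) :=
  fun _ => inferInstanceAs (Decidable (_ ∧ _))

/-- The principal minor of `B` on the index set `p`. -/
noncomputable def minor (B : Matrix (Fin n) (Fin n) ℂ) (p : Fin n → Prop) [DecidablePred p] : ℝ :=
  (B.submatrix (Subtype.val : {j // p j} → Fin n) Subtype.val).det.re

theorem minor_pos {B : Matrix (Fin n) (Fin n) ℂ} (hB : B.PosDef) (p : Fin n → Prop)
    [DecidablePred p] : 0 < minor B p :=
  (posDef_det_eq_re (hB.submatrix Subtype.val_injective)).2

theorem coe_minor {B : Matrix (Fin n) (Fin n) ℂ} (hB : B.PosDef) (p : Fin n → Prop)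
    [DecidablePred p] :
    (B.submatrix (Subtype.val : {j // p j} → Fin n) Subtype.val).det = minor B p :=
  (posDef_det_eq_re (hB.submatrix Subtype.val_injective)).1

/-- Row `i` of `C` is the conjugate of `v i / √(v i i)`, where `v i` is supported on the window of
`i` and `B (v i)` equals the unit vector `e i` there. By Cramer's rule `v i i` is a ratio of minors,
hence positive. -/
theorem exists_band_factor {B : Matrix (Fin n) (Fin n) ℂ} (hB : B.PosDef) (K : ℕ) :
    ∃ (C : Matrix (Fin n) (Fin n) ℂ) (c : Fin n → ℝ),
      (∀ i j, ¬ InWindow K i j → C i j = 0) ∧ (∀ i, 0 < c i) ∧ (∀ i, C i i = c i) ∧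
      (∀ i j, InWindow K i j → (B * Cᴴ) j i = if j = i then (c i : ℂ)⁻¹ else 0) ∧
      ∀ i, c i ^ 2 = minor B (fun j => InWindow K i j ∧ j ≠ i) / minor B (InWindow K i) := by
  have hu : ∀ i : Fin n,
      IsUnit (B.submatrix (Subtype.val : {j // InWindow K i j} → Fin n) Subtype.val).det := by
    intro i
    rw [coe_minor hB]
    exact isUnit_iff_ne_zero.2 (Complex.ofReal_ne_zero.2 (minor_pos hB _).ne')
  choose v hv0 hv1 hv2 using fun i : Fin n =>
    exists_window_solution B (InWindow K i) (hu i) i ⟨le_rfl, by simp⟩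
  set t : Fin n → ℝ :=
    fun i => minor B (fun j => InWindow K i j ∧ j ≠ i) / minor B (InWindow K i) with ht
  have htpos : ∀ i, 0 < t i := fun i => div_pos (minor_pos hB _) (minor_pos hB _)
  have hvt : ∀ i, v i i = t i := by
    intro i
    have := hv2 i
    rw [coe_minor hB, coe_minor hB] at this
    have hne : (minor B (InWindow K i) : ℂ) ≠ 0 :=
      Complex.ofReal_ne_zero.2 (minor_pos hB _).ne'
    simp only [ht]
    push_cast
    rw [eq_div_iff hne, mul_comm, this]
  have hs : ∀ i, (Real.sqrt (t i) : ℂ) * Real.sqrt (t i) = t i := by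
    intro i
    rw [← Complex.ofReal_mul, Real.mul_self_sqrt (htpos i).le]
  have hs0 : ∀ i, (Real.sqrt (t i) : ℂ) ≠ 0 := fun i =>
    Complex.ofReal_ne_zero.2 (Real.sqrt_pos.2 (htpos i)).ne'
  refine ⟨Matrix.of fun i j => star (v i j) * (Real.sqrt (t i) : ℂ)⁻¹,
    fun i => Real.sqrt (t i), ?_, fun i => Real.sqrt_pos.2 (htpos i), ?_, ?_, ?_⟩
  · intro i j hij
    simp [hv0 i j hij]
  · intro i
    rw [Matrix.of_apply, hvt, ← hs i]
    have := hs0 i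
    simp only [RCLike.star_def, map_mul, Complex.conj_ofReal]
    field_simp
  · intro i j hij
    have : (B * (Matrix.of fun i j => star (v i j) * (Real.sqrt (t i) : ℂ)⁻¹)ᴴ) j i
        = (B *ᵥ v i) j * (Real.sqrt (t i) : ℂ)⁻¹ := by
      rw [Matrix.mul_apply, Matrix.mulVec, dotProduct, Finset.sum_mul]
      refine Finset.sum_congr rfl fun k _ => ?_
      simp [Matrix.conjTranspose_apply, mul_assoc]
    rw [this, hv1 i j hij]
    split_ifs <;> simp
  · intro i
    exact Real.sq_sqrt (htpos i).le

/-- A nonzero term would need a row whose window contains both indices, and these then differ by at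
most `K`. -/
theorem band_gram {C : Matrix (Fin n) (Fin n) ℂ} {K : ℕ}
    (hC : ∀ i j, ¬ InWindow K i j → C i j = 0) (i j : Fin n)
    (hij : (i : ℕ) + K < j ∨ (j : ℕ) + K < i) : (Cᴴ * C) i j = 0 := by
  rw [Matrix.mul_apply]
  refine Finset.sum_eq_zero fun k _ => ?_
  by_cases h1 : InWindow K k i
  · have h2 : ¬ InWindow K k j := by unfold InWindow at *; omega
    rw [hC k j h2, mul_zero]
  · rw [Matrix.conjTranspose_apply, hC k i h1, star_zero, zero_mul]

theorem band_det {C : Matrix (Fin n) (Fin n) ℂ} {c : Fin n → ℝ} {K : ℕ}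
    (hC : ∀ i j, ¬ InWindow K i j → C i j = 0) (hc : ∀ i, C i i = c i) :
    C.det = ((∏ i, c i : ℝ) : ℂ) := by
  rw [Matrix.det_of_isUpperTriangular]
  · push_cast
    exact Finset.prod_congr rfl fun i _ => hc i
  · intro i j hij
    refine hC i j fun h => ?_
    have : (j : ℕ) < i := hij
    exact absurd h.1 (by omega)

/-- The inverse of the banded Gram matrix agrees with `B` on the band. -/
theorem band_inv_eq {B C : Matrix (Fin n) (Fin n) ℂ} {c : Fin n → ℝ} {K : ℕ}
    (hB : B.IsHermitian) (hC : ∀ i j, ¬ InWindow K i j → C i j = 0) (hpos : ∀ i, 0 < c i)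
    (hc : ∀ i, C i i = c i)
    (hBC : ∀ i j, InWindow K i j → (B * Cᴴ) j i = if j = i then (c i : ℂ)⁻¹ else 0)
    (i j : Fin n) (hij : (i : ℕ) ≤ j + K) (hji : (j : ℕ) ≤ i + K) :
    (Cᴴ * C)⁻¹ i j = B i j := by
  have hCd : IsUnit C.det := by
    rw [band_det hC hc]
    exact isUnit_iff_ne_zero.2
      (Complex.ofReal_ne_zero.2 (Finset.prod_pos fun i _ => hpos i).ne')
  have hCt : IsUnit Cᴴ.det := by
    rw [Matrix.det_conjTranspose]; exact hCd.star
  have htri : C.BlockTriangular id := by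
    intro i j hij
    refine hC i j fun h => ?_
    have : (j : ℕ) < i := hij
    exact absurd h.1 (by omega)
  have := Matrix.invertibleOfIsUnitDet C hCd
  have htri' : C⁻¹.BlockTriangular id := Matrix.blockTriangular_inv_of_blockTriangular htri
  have hdiag : ∀ i, C⁻¹ i i = (c i : ℂ)⁻¹ := by
    intro i
    have h1 := congrFun (congrFun (Matrix.mul_nonsing_inv C hCd) i) i
    rw [Matrix.mul_apply, Finset.sum_eq_single i, Matrix.one_apply_eq, hc] at h1
    · exact eq_inv_of_mul_eq_one_right h1
    · intro k _ hk
      rcases lt_or_gt_of_ne hk with h | h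
      · rw [htri h, zero_mul]
      · rw [htri' h, mul_zero]
    · simp
  set X := (Cᴴ * C)⁻¹ with hX
  -- `X Cᴴ` is upper triangular with diagonal `1 / c i`, so it has exactly the values prescribed for
  -- `B Cᴴ` on the windows.
  have hXC : X * Cᴴ = C⁻¹ := by
    rw [hX, Matrix.mul_inv_rev, Matrix.mul_assoc, Matrix.nonsing_inv_mul _ hCt, Matrix.mul_one]
  have hXh : X.IsHermitian := (Matrix.isHermitian_conjTranspose_mul_self C).inv
  have hD : (X - B).IsHermitian := hXh.sub hB
  have key : ∀ i j, InWindow K i j → ((X - B) * Cᴴ) j i = 0 := by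
    intro i j hij
    rw [Matrix.sub_mul, Matrix.sub_apply, hXC, hBC i j hij]
    split_ifs with h
    · rw [h, hdiag, sub_self]
    · rw [sub_zero]
      refine htri' ?_
      have : (i : ℕ) ≠ j := fun h' => h (Fin.ext h'.symm)
      exact lt_of_le_of_ne hij.1 (fun h' => h h'.symm)
  -- Backward induction over the columns, the last `m` being done. Since `c i ≠ 0`, `key` expresses
  -- entry `(j, i)` of `X - B` through the entries `(j, k)` with `k ≠ i` in the window of `i`.
  have main : ∀ m : ℕ, ∀ i j : Fin n, n - m ≤ (i : ℕ) → InWindow K i j →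
      (X - B) j i = 0 := by
    intro m
    induction m with
    | zero => intro i j hi; exact absurd i.2 (by omega)
    | succ m ih =>
      have off : ∀ i j : Fin n, n - (m + 1) ≤ (i : ℕ) → InWindow K i j →
          (∀ k, InWindow K i k → k ≠ i → (X - B) j k = 0) → (X - B) j i = 0 := by
        intro i j hi hij hk
        have h := key i j hij
        rw [Matrix.mul_apply, Finset.sum_eq_single i] at h
        · rw [Matrix.conjTranspose_apply, hc] at h
          refine (mul_eq_zero.1 h).resolve_right ?_
          simpa using (hpos i).ne'
        · intro k _ hki
          by_cases hw : InWindow K i k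
          · rw [hk k hw hki, zero_mul]
          · rw [Matrix.conjTranspose_apply, hC i k hw, star_zero, mul_zero]
        · simp
      -- Here `j` and `k` both exceed `i` and lie within `K` of each other, so the induction
      -- hypothesis applies, up to Hermitian symmetry. The diagonal entry must come afterwards, as
      -- it uses these off-diagonal ones.
      have later : ∀ i j : Fin n, n - (m + 1) ≤ (i : ℕ) → InWindow K i j → j ≠ i →
          (X - B) j i = 0 := by
        intro i j hi hij hne
        refine off i j hi hij fun k hk hki => ?_
        have h1 : (j : ℕ) ≠ i := fun h => hne (Fin.ext h)
        have h2 : (k : ℕ) ≠ i := fun h => hki (Fin.ext h)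
        unfold InWindow at *
        rcases le_total (k : ℕ) j with h | h
        · exact ih k j (by omega) ⟨h, by omega⟩
        · rw [← hD.apply, ih j k (by omega) ⟨h, by omega⟩, star_zero]
      intro i j hi hij
      by_cases hne : j = i
      · subst hne
        refine off j j hi hij fun k hk hki => ?_
        rw [← hD.apply, later j k hi hk hki, star_zero]
      · exact later i j hi hij hne
  have hfin : (X - B) i j = 0 := by
    rcases le_total (i : ℕ) j with h | h
    · rw [← hD.apply, main n i j (by omega) ⟨h, by omega⟩, star_zero]
    · exact main n j i (by omega) ⟨h, by omega⟩
  rwa [Matrix.sub_apply, sub_eq_zero] at hfin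

/-- Maximum of `log det M - tr (M B) + n` over banded positive definite matrices `M`. -/
theorem exists_band_maximizer {B : Matrix (Fin n) (Fin n) ℂ} (hB : B.PosDef) (K : ℕ) :
    ∃ M₀ ∈ bandHermitian n K, M₀.PosDef ∧
      Real.log M₀.det.re - (M₀ * B).trace.re + n =
        ∑ i : Fin n, (Real.log (minor B fun j => InWindow K i j ∧ j ≠ i) -
          Real.log (minor B (InWindow K i))) ∧
      ∀ M ∈ bandHermitian n K, M.PosDef →
        Real.log M.det.re - (M * B).trace.re ≤ Real.log M₀.det.re - (M₀ * B).trace.re := by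
  obtain ⟨C, c, hC, hpos, hc, hBC, hcm⟩ := exists_band_factor hB K
  have hdet := band_det hC hc
  have hprod : 0 < ∏ i, c i := Finset.prod_pos fun i _ => hpos i
  have hCd : IsUnit C.det := by
    rw [hdet]; exact isUnit_iff_ne_zero.2 (Complex.ofReal_ne_zero.2 hprod.ne')
  have hCu : IsUnit C := (Matrix.isUnit_iff_isUnit_det _).2 hCd
  have hP : (Cᴴ * C).PosDef :=
    Matrix.PosDef.conjTranspose_mul_self C (Matrix.mulVec_injective_of_isUnit hCu)
  have hband : Cᴴ * C ∈ bandHermitian n K := ⟨hP.1, band_gram hC⟩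
  have htr : ∀ M ∈ bandHermitian n K, (M * B).trace = ((Cᴴ * C)⁻¹ * M).trace := by
    intro M hM
    rw [Matrix.trace_mul_comm M B]
    simp only [Matrix.trace, Matrix.diag, Matrix.mul_apply]
    refine Finset.sum_congr rfl fun i _ => Finset.sum_congr rfl fun j _ => ?_
    by_cases h : (i : ℕ) ≤ j + K ∧ (j : ℕ) ≤ i + K
    · rw [band_inv_eq hB.1 hC hpos hc hBC i j h.1 h.2]
    · rw [hM.2 j i (by omega), mul_zero, mul_zero]
  have hPdet : IsUnit (Cᴴ * C).det := (Matrix.isUnit_iff_isUnit_det _).1 hP.isUnit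
  -- `Cᴴ * C` is itself banded, so `B` may be replaced by its inverse.
  have htr0 : (Cᴴ * C * B).trace = n := by
    rw [htr _ hband, Matrix.nonsing_inv_mul _ hPdet, Matrix.trace_one, Fintype.card_fin]
  have htr0' : (Cᴴ * C * B).trace.re = n := by rw [htr0]; simp
  refine ⟨Cᴴ * C, hband, hP, ?_, ?_⟩
  · rw [htr0', sub_add_cancel, Matrix.det_mul, Matrix.det_conjTranspose, hdet, RCLike.star_def,
      Complex.conj_ofReal, ← Complex.ofReal_mul, Complex.ofReal_re,
      ← Finset.prod_mul_distrib, Real.log_prod (fun i _ => (mul_pos (hpos i) (hpos i)).ne')]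
    refine Finset.sum_congr rfl fun i _ => ?_
    rw [← sq, hcm, Real.log_div (minor_pos hB _).ne' (minor_pos hB _).ne']
  · intro M hM hMp
    have := log_det_le_of_factor hMp hCd
    rw [← htr M hM, Fintype.card_fin] at this
    rw [htr0']
    linarith

end Band

/-! ### Gaussian integrals of Hermitian forms and the receiver marginal -/

section Gaussian

theorem lintegral_pi_prod : ∀ {n : ℕ} (μ : Fin n → Measure ℂ) [∀ i, SigmaFinite (μ i)]
    (f : Fin n → ℂ → ℝ≥0∞), (∀ i, Measurable (f i)) →
    ∫⁻ x, ∏ i, f i (x i) ∂(Measure.pi μ) = ∏ i, ∫⁻ z, f i z ∂(μ i)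
  | 0, μ, _, f, _ => by simp
  | n + 1, μ, _, f, hf => by
    have h := (measurePreserving_piFinSuccAbove μ 0).symm
    rw [← h.lintegral_comp_emb (MeasurableEquiv.measurableEmbedding _)]
    simp only [Fin.prod_univ_succ]
    have : ∀ a : ℂ × (Fin n → ℂ),
        f 0 ((MeasurableEquiv.piFinSuccAbove (fun _ => ℂ) 0).symm a 0) *
          ∏ i : Fin n, f i.succ ((MeasurableEquiv.piFinSuccAbove (fun _ => ℂ) 0).symm a i.succ) =
        f 0 a.1 * ∏ i : Fin n, f i.succ (a.2 i) := by
      intro a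
      simp [MeasurableEquiv.piFinSuccAbove]
    simp only [this, Fin.zero_succAbove]
    rw [lintegral_prod_mul (g := fun x : Fin n → ℂ => ∏ i, f i.succ (x i)) (hf 0).aemeasurable
      (Finset.measurable_prod _ fun i _ =>
        (hf i.succ).comp (measurable_pi_apply i)).aemeasurable,
      lintegral_pi_prod (fun i : Fin n => μ i.succ) (fun i => f i.succ) fun i => hf i.succ]

theorem lintegral_exp_of_pos {l : ℝ} (hl : 0 < l) (w : ℂ) :
    ∫⁻ z : ℂ, ENNReal.ofReal (Real.exp (2 * (star z * w).re - l * ‖z‖ ^ 2)) =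
      ENNReal.ofReal (Real.pi / l * Real.exp (‖w‖ ^ 2 / l)) := by
  have hb : 0 < (l : ℂ).re := by simpa using hl
  have he : ∀ z : ℂ, Complex.exp (-(l : ℂ) * (‖z‖ : ℂ) ^ 2 + 2 * ((inner ℝ w z : ℝ) : ℂ)) =
      ((Real.exp (2 * (star z * w).re - l * ‖z‖ ^ 2) : ℝ) : ℂ) := by
    intro z
    rw [Complex.ofReal_exp]
    congr 1
    have : inner ℝ w z = (star z * w).re := by
      simp [Complex.inner]
    rw [this]
    push_cast
    ring
  have hi := GaussianFourier.integrable_cexp_neg_mul_sq_norm_add hb 2 w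
  have hI := GaussianFourier.integral_cexp_neg_mul_sq_norm_add hb 2 w
  simp only [he] at hi hI
  have hi' : Integrable fun z : ℂ => Real.exp (2 * (star z * w).re - l * ‖z‖ ^ 2) := by
    exact hi.re.congr (Filter.Eventually.of_forall fun z => Complex.ofReal_re _)
  rw [← ofReal_integral_eq_lintegral_ofReal hi' (Filter.Eventually.of_forall fun z =>
    (Real.exp_pos _).le)]
  congr 1
  -- The real dimension of `ℂ` is `2`, so the power `dim / 2` of `π / l` is `1`.
  rw [integral_complex_ofReal, Complex.finrank_real_complex] at hI
  have hr : ((Real.pi : ℂ) / l) ^ (((2 : ℕ) : ℂ) / 2) *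
      Complex.exp (2 ^ 2 * (‖w‖ : ℂ) ^ 2 / (4 * l)) =
      ((Real.pi / l * Real.exp (‖w‖ ^ 2 / l) : ℝ) : ℂ) := by
    push_cast
    rw [div_self (two_ne_zero), Complex.cpow_one]
    congr 2
    have : (l : ℂ) ≠ 0 := Complex.ofReal_ne_zero.2 hl.ne'
    field_simp
    ring
  rw [hr] at hI
  exact Complex.ofReal_injective hI

/-- At one of `z` and `-z` the linear term is nonnegative, so the integrand there is at least `1`;
symmetrizing compares with the infinite volume of `ℂ`. -/
theorem lintegral_exp_of_nonpos {l : ℝ} (hl : l ≤ 0) (w : ℂ) :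
    ∫⁻ z : ℂ, ENNReal.ofReal (Real.exp (2 * (star z * w).re - l * ‖z‖ ^ 2)) = ⊤ := by
  set f : ℂ → ℝ≥0∞ := fun z => ENNReal.ofReal (Real.exp (2 * (star z * w).re - l * ‖z‖ ^ 2))
    with hf
  have hm : Measurable f := by
    have : Continuous fun z : ℂ => Real.exp (2 * (star z * w).re - l * ‖z‖ ^ 2) := by fun_prop
    exact this.measurable.ennreal_ofReal
  have h1 : ∫⁻ z, f (-z) = ∫⁻ z, f z :=
    (Measure.measurePreserving_neg (volume : Measure ℂ)).lintegral_comp hm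
  have h2 : ∀ z, (1 : ℝ≥0∞) ≤ f z + f (-z) := by
    intro z
    have key : ∀ z : ℂ, 0 ≤ (star z * w).re → 1 ≤ f z := by
      intro z hz
      rw [hf, ← ENNReal.ofReal_one]
      refine ENNReal.ofReal_le_ofReal (Real.one_le_exp ?_)
      nlinarith [sq_nonneg ‖z‖]
    rcases le_total 0 (star z * w).re with h | h
    · exact (key z h).trans le_self_add
    · refine (key (-z) ?_).trans le_add_self
      rw [star_neg, neg_mul, Complex.neg_re]
      linarith
  have h3 : (⊤ : ℝ≥0∞) ≤ ∫⁻ z, f z + f (-z) := by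
    calc (⊤ : ℝ≥0∞) = ∫⁻ _ : ℂ, 1 := by
          rw [lintegral_one, measure_univ_of_isAddLeftInvariant]
      _ ≤ _ := lintegral_mono h2
  rw [lintegral_add_left hm, h1, top_le_iff, ENNReal.add_eq_top, or_self] at h3
  exact h3

variable {n : ℕ}

/-- The real determinant of a complex-linear map is the squared modulus of its complex determinant,
here `1`. -/
theorem measurePreserving_mulVec_unitary (U : Matrix.unitaryGroup (Fin n) ℂ) :
    MeasurePreserving (fun x : Fin n → ℂ => (U : Matrix (Fin n) (Fin n) ℂ) *ᵥ x) := by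
  set L : (Fin n → ℂ) →ₗ[ℝ] (Fin n → ℂ) :=
    (Matrix.toLin' (U : Matrix (Fin n) (Fin n) ℂ)).restrictScalars ℝ with hL
  have hdet : LinearMap.det L = 1 := by
    have h := (Unitary.mem_iff.1 (Matrix.det_of_mem_unitary U.2)).1
    rw [RCLike.star_def, ← Complex.normSq_eq_conj_mul_self] at h
    rw [hL, LinearMap.det_restrictScalars, LinearMap.det_toLin', Algebra.norm_complex_apply]
    exact_mod_cast h
  have h := Measure.map_linearMap_addHaar_eq_smul_addHaar
    (volume : Measure (Fin n → ℂ)) (f := L) (by rw [hdet]; exact one_ne_zero)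
  rw [hdet] at h
  refine ⟨?_, ?_⟩
  · exact (Continuous.matrix_mulVec continuous_const continuous_id).measurable
  · simp only [inv_one, abs_one, ENNReal.ofReal_one, one_smul] at h
    exact h

theorem star_dotProduct_diagonal (d : Fin n → ℝ) (z : Fin n → ℂ) :
    star z ⬝ᵥ ((Matrix.diagonal fun i => (d i : ℂ)) *ᵥ z) =
      ((∑ i, d i * ‖z i‖ ^ 2 : ℝ) : ℂ) := by
  push_cast
  rw [dotProduct]
  refine Finset.sum_congr rfl fun i _ => ?_
  rw [Matrix.mulVec_diagonal, Pi.star_apply, ← Complex.conj_mul', RCLike.star_def]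
  ring

theorem star_mulVec_dotProduct (A : Matrix (Fin n) (Fin n) ℂ) (x y : Fin n → ℂ) :
    star (A *ᵥ x) ⬝ᵥ y = star x ⬝ᵥ (Aᴴ *ᵥ y) := by
  rw [Matrix.star_mulVec, Matrix.dotProduct_mulVec]

theorem spectral_form {M : Matrix (Fin n) (Fin n) ℂ} (hM : M.IsHermitian) :
    (hM.eigenvectorUnitary : Matrix (Fin n) (Fin n) ℂ)ᴴ * M * hM.eigenvectorUnitary =
      Matrix.diagonal fun i => (hM.eigenvalues i : ℂ) := by
  have h := hM.conjStarAlgAut_star_eigenvectorUnitary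
  rw [Unitary.conjStarAlgAut_apply] at h
  simpa [Matrix.star_eq_conjTranspose, Function.comp_def] using h

/-- Gaussian integral of a Hermitian quadratic form, in its eigenbasis. -/
theorem lintegral_exp_quadratic {M : Matrix (Fin n) (Fin n) ℂ} (hM : M.IsHermitian)
    (v : Fin n → ℂ) :
    ∫⁻ x : Fin n → ℂ,
        ENNReal.ofReal (Real.exp (2 * (star x ⬝ᵥ v).re - (star x ⬝ᵥ (M *ᵥ x)).re)) =
      ∏ i, ∫⁻ z : ℂ, ENNReal.ofReal (Real.exp
        (2 * (star z * ((hM.eigenvectorUnitary : Matrix (Fin n) (Fin n) ℂ)ᴴ *ᵥ v) i).re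
          - hM.eigenvalues i * ‖z‖ ^ 2)) := by
  set U : Matrix (Fin n) (Fin n) ℂ := hM.eigenvectorUnitary.1 with hU
  have hmeas : Measurable fun x : Fin n → ℂ =>
      ENNReal.ofReal (Real.exp (2 * (star x ⬝ᵥ v).re - (star x ⬝ᵥ (M *ᵥ x)).re)) := by
    have : Continuous fun x : Fin n → ℂ =>
        Real.exp (2 * (star x ⬝ᵥ v).re - (star x ⬝ᵥ (M *ᵥ x)).re) := by
      simp only [dotProduct, Matrix.mulVec, Pi.star_apply]
      fun_prop
    exact this.measurable.ennreal_ofReal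
  rw [← (measurePreserving_mulVec_unitary hM.eigenvectorUnitary).lintegral_comp hmeas,
    ← lintegral_pi_prod, ← volume_pi]
  · refine lintegral_congr fun z => ?_
    rw [← ENNReal.ofReal_prod_of_nonneg fun i _ => (Real.exp_pos _).le, ← Real.exp_sum]
    congr 2
    rw [← hU, star_mulVec_dotProduct, star_mulVec_dotProduct, Matrix.mulVec_mulVec,
      Matrix.mulVec_mulVec, spectral_form hM, star_dotProduct_diagonal,
      Complex.ofReal_re, Finset.sum_sub_distrib, ← Finset.mul_sum, dotProduct, Complex.re_sum]
    rfl
  · intro i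
    have : Continuous fun z : ℂ => Real.exp (2 * (star z * (Uᴴ *ᵥ v) i).re
          - hM.eigenvalues i * ‖z‖ ^ 2) := by fun_prop
    exact this.measurable.ennreal_ofReal

theorem lintegral_exp_quadratic_of_posDef {M : Matrix (Fin n) (Fin n) ℂ} (hM : M.PosDef)
    (v : Fin n → ℂ) :
    ∫⁻ x : Fin n → ℂ,
        ENNReal.ofReal (Real.exp (2 * (star x ⬝ᵥ v).re - (star x ⬝ᵥ (M *ᵥ x)).re)) =
      ENNReal.ofReal (Real.pi ^ n * (M.det.re)⁻¹ *
        Real.exp (star v ⬝ᵥ (M⁻¹ *ᵥ v)).re) := by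
  rw [lintegral_exp_quadratic hM.1]
  set U : Matrix (Fin n) (Fin n) ℂ := hM.1.eigenvectorUnitary.1 with hU
  set l := hM.1.eigenvalues with hl
  have hlpos : ∀ i, 0 < l i := hM.eigenvalues_pos
  simp only [lintegral_exp_of_pos (hlpos _)]
  rw [← ENNReal.ofReal_prod_of_nonneg fun i _ => by have := hlpos i; positivity,
    Finset.prod_mul_distrib, ← Real.exp_sum]
  congr 2
  · have : M.det = ((∏ i, l i : ℝ) : ℂ) := by
      rw [hM.1.det_eq_prod_eigenvalues]; push_cast; rfl
    rw [this, Complex.ofReal_re, Finset.prod_div_distrib, Finset.prod_const, Finset.card_univ,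
      Fintype.card_fin, div_eq_mul_inv]
  · congr 1
    have hUU : Uᴴ * U = 1 := Matrix.UnitaryGroup.star_mul_self _
    have hUU' : U * Uᴴ = 1 := mul_eq_one_comm.1 hUU
    have hinv : M⁻¹ = U * (Matrix.diagonal fun i => (((l i)⁻¹ : ℝ) : ℂ)) * Uᴴ := by
      refine Matrix.inv_eq_left_inv ?_
      have h1 : Uᴴ * M = (Matrix.diagonal fun i => (l i : ℂ)) * Uᴴ := by
        rw [← spectral_form hM.1, ← hU, Matrix.mul_assoc, hUU', Matrix.mul_one]
      rw [Matrix.mul_assoc, h1, Matrix.mul_assoc, ← Matrix.mul_assoc (Matrix.diagonal _),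
        Matrix.diagonal_mul_diagonal]
      have h2 : (fun i => (((l i)⁻¹ : ℝ) : ℂ) * (l i : ℂ)) = fun _ => 1 := by
        funext i
        rw [← Complex.ofReal_mul, inv_mul_cancel₀ (hlpos i).ne', Complex.ofReal_one]
      rw [h2, Matrix.diagonal_one, Matrix.one_mul, hUU']
    have h3 : star v ⬝ᵥ (M⁻¹ *ᵥ v) =
        star (Uᴴ *ᵥ v) ⬝ᵥ ((Matrix.diagonal fun i => (((l i)⁻¹ : ℝ) : ℂ)) *ᵥ (Uᴴ *ᵥ v)) := by
      rw [star_mulVec_dotProduct, Matrix.conjTranspose_conjTranspose, Matrix.mulVec_mulVec,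
        Matrix.mulVec_mulVec, hinv]
    rw [h3, star_dotProduct_diagonal, Complex.ofReal_re]
    refine Finset.sum_congr rfl fun i _ => ?_
    rw [div_eq_inv_mul]

theorem lintegral_exp_quadratic_of_not_posDef {M : Matrix (Fin n) (Fin n) ℂ}
    (hM : M.IsHermitian) (hn : ¬ M.PosDef) (v : Fin n → ℂ) :
    ∫⁻ x : Fin n → ℂ,
        ENNReal.ofReal (Real.exp (2 * (star x ⬝ᵥ v).re - (star x ⬝ᵥ (M *ᵥ x)).re)) = ⊤ := by
  rw [lintegral_exp_quadratic hM]
  rw [hM.posDef_iff_eigenvalues_pos, not_forall] at hn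
  obtain ⟨i, hi⟩ := hn
  rw [← Finset.mul_prod_erase _ _ (Finset.mem_univ i), lintegral_exp_of_nonpos (not_lt.1 hi)]
  -- Since `⊤ * 0 = 0` in `ℝ≥0∞`, the remaining factors must be shown nonzero.
  refine ENNReal.top_mul (Finset.prod_ne_zero_iff.2 fun j _ => ?_)
  by_cases hj : 0 < hM.eigenvalues j
  · rw [lintegral_exp_of_pos hj]
    exact (ENNReal.ofReal_pos.2 (by positivity)).ne'
  · rw [lintegral_exp_of_nonpos (not_lt.1 hj)]
    exact ENNReal.top_ne_zero

theorem receiverFun_mul_cscgPDF {nR nT : ℕ} (Hr : Matrix (Fin nT) (Fin nR) ℂ)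
    (Gr : Matrix (Fin nT) (Fin nT) ℂ) (y : Fin nR → ℂ) (x : Fin nT → ℂ) :
    receiverFun Hr Gr y x * cscgPDF nT 1 x = (Real.pi ^ nT)⁻¹ *
      Real.exp (2 * (star x ⬝ᵥ (Hr *ᵥ y)).re - (star x ⬝ᵥ ((1 + Gr) *ᵥ x)).re) := by
  have h : (star x ⬝ᵥ ((1 + Gr) *ᵥ x)).re = (∑ i, ‖x i‖ ^ 2) + (star x ⬝ᵥ (Gr *ᵥ x)).re := by
    have h1 := star_dotProduct_diagonal (fun _ => 1) x
    simp only [Complex.ofReal_one, Matrix.diagonal_one, one_mul] at h1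
    rw [Matrix.add_mulVec, dotProduct_add, h1, Complex.add_re, Complex.ofReal_re]
  rw [receiverFun, cscgPDF, h, mul_one, mul_left_comm, ← Real.exp_add, div_one]
  congr 2
  ring

theorem receiverMarginal_eq {nR nT : ℕ} (Hr : Matrix (Fin nT) (Fin nR) ℂ)
    (Gr : Matrix (Fin nT) (Fin nT) ℂ) (y : Fin nR → ℂ) :
    receiverMarginal Hr Gr y = ENNReal.ofReal (Real.pi ^ nT)⁻¹ * ∫⁻ x : Fin nT → ℂ,
      ENNReal.ofReal (Real.exp
        (2 * (star x ⬝ᵥ (Hr *ᵥ y)).re - (star x ⬝ᵥ ((1 + Gr) *ᵥ x)).re)) := by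
  rw [receiverMarginal, ← lintegral_const_mul' _ _ ENNReal.ofReal_ne_top]
  refine lintegral_congr fun x => ?_
  rw [receiverFun_mul_cscgPDF, ENNReal.ofReal_mul (by positivity)]

theorem log_receiverMarginal_of_posDef {nR nT : ℕ} (Hr : Matrix (Fin nT) (Fin nR) ℂ)
    {Gr : Matrix (Fin nT) (Fin nT) ℂ} (hM : (1 + Gr).PosDef) (y : Fin nR → ℂ) :
    ENNReal.log (receiverMarginal Hr Gr y) =
      ((-Real.log (1 + Gr).det.re + (star (Hr *ᵥ y) ⬝ᵥ ((1 + Gr)⁻¹ *ᵥ (Hr *ᵥ y))).re : ℝ) :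
        EReal) := by
  have hd := (posDef_det_eq_re hM).2
  rw [receiverMarginal_eq, lintegral_exp_quadratic_of_posDef hM,
    ← ENNReal.ofReal_mul (by positivity), ← mul_assoc, ← mul_assoc,
    inv_mul_cancel₀ (by positivity), one_mul, ENNReal.log_ofReal, if_neg (by push Not; positivity),
    Real.log_mul (by positivity) (Real.exp_pos _).ne', Real.log_inv, Real.log_exp]

theorem log_receiverMarginal_of_not_posDef {nR nT : ℕ} (Hr : Matrix (Fin nT) (Fin nR) ℂ)
    {Gr : Matrix (Fin nT) (Fin nT) ℂ} (hG : Gr.IsHermitian) (hM : ¬ (1 + Gr).PosDef)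
    (y : Fin nR → ℂ) :
    ENNReal.log (receiverMarginal Hr Gr y) = ⊤ := by
  rw [receiverMarginal_eq, lintegral_exp_quadratic_of_not_posDef (Matrix.isHermitian_one.add hG) hM,
    ENNReal.mul_top (ENNReal.ofReal_pos.2 (by positivity)).ne', ENNReal.log_top]

end Gaussian

/-! ### Second moments of complex Gaussian vectors -/

section Moments

/-- The one-dimensional circularly-symmetric complex Gaussian law. -/
noncomputable def cscgOne (s : ℝ) : Measure ℂ :=
  volume.withDensity fun z => ENNReal.ofReal ((Real.pi * s)⁻¹ * Real.exp (-‖z‖ ^ 2 / s))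

theorem measurable_cscgOne_density (s : ℝ) :
    Measurable fun z : ℂ => ENNReal.ofReal ((Real.pi * s)⁻¹ * Real.exp (-‖z‖ ^ 2 / s)) := by
  have : Continuous fun z : ℂ => (Real.pi * s)⁻¹ * Real.exp (-‖z‖ ^ 2 / s) := by fun_prop
  exact this.measurable.ennreal_ofReal

theorem isProbabilityMeasure_cscgOne {s : ℝ} (hs : 0 < s) : IsProbabilityMeasure (cscgOne s) := by
  refine ⟨?_⟩
  rw [cscgOne, withDensity_apply _ MeasurableSet.univ, Measure.restrict_univ]
  have h := lintegral_exp_of_pos (inv_pos.2 hs) 0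
  simp only [mul_zero, Complex.zero_re, zero_sub, norm_zero, ne_eq, OfNat.ofNat_ne_zero,
    not_false_eq_true, zero_pow, div_inv_eq_mul, zero_mul, Real.exp_zero, mul_one] at h
  have h' : ∀ z : ℂ, ENNReal.ofReal ((Real.pi * s)⁻¹ * Real.exp (-‖z‖ ^ 2 / s)) =
      ENNReal.ofReal (Real.pi * s)⁻¹ * ENNReal.ofReal (Real.exp (-(s⁻¹ * ‖z‖ ^ 2))) := by
    intro z
    rw [← ENNReal.ofReal_mul (by positivity)]
    congr 3
    field_simp
  simp only [h']
  rw [lintegral_const_mul' _ _ ENNReal.ofReal_ne_top, h, ← ENNReal.ofReal_mul (by positivity),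
    inv_mul_cancel₀ (by positivity), ENNReal.ofReal_one]

/-- The density factors over coordinates. This reduces moments to one dimension and makes the
coordinates independent. -/
theorem cscg_eq_pi (n : ℕ) {s : ℝ} (hs : 0 < s) :
    cscg n s = Measure.pi fun _ : Fin n => cscgOne s := by
  have := isProbabilityMeasure_cscgOne hs
  refine (Measure.pi_eq fun t ht => ?_).symm
  rw [cscg, withDensity_apply _ (MeasurableSet.univ_pi ht), volume_pi, Measure.restrict_pi_pi]
  have h : ∀ x : Fin n → ℂ, ENNReal.ofReal (cscgPDF n s x) =
      ∏ i, ENNReal.ofReal ((Real.pi * s)⁻¹ * Real.exp (-‖x i‖ ^ 2 / s)) := by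
    intro x
    rw [← ENNReal.ofReal_prod_of_nonneg fun i _ => by positivity, Finset.prod_mul_distrib,
      ← Real.exp_sum, cscgPDF, Finset.prod_const, Finset.card_univ, Fintype.card_fin, inv_pow,
      ← Finset.sum_div, Finset.sum_neg_distrib]
  simp only [h]
  rw [lintegral_pi_prod _ _ fun _ => measurable_cscgOne_density s]
  refine Finset.prod_congr rfl fun i _ => ?_
  rw [cscgOne, withDensity_apply _ (ht i)]

theorem integral_cscgOne {E : Type*} [NormedAddCommGroup E] [NormedSpace ℝ E] {s : ℝ}
    (hs : 0 < s) (f : ℂ → E) :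
    ∫ z, f z ∂(cscgOne s) =
      ∫ z, ((Real.pi * s)⁻¹ * Real.exp (-‖z‖ ^ 2 / s)) • f z := by
  rw [cscgOne, integral_withDensity_eq_integral_toReal_smul (measurable_cscgOne_density s)
    (Filter.Eventually.of_forall fun _ => ENNReal.ofReal_lt_top)]
  refine integral_congr_ae (Filter.Eventually.of_forall fun z => ?_)
  simp only
  rw [ENNReal.toReal_ofReal (by positivity)]

theorem integral_id_cscgOne {s : ℝ} (hs : 0 < s) : ∫ z, z ∂(cscgOne s) = 0 := by
  rw [integral_cscgOne hs]
  have h := integral_neg_eq_self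
    (fun z : ℂ => ((Real.pi * s)⁻¹ * Real.exp (-‖z‖ ^ 2 / s)) • z) volume
  simp only [norm_neg, smul_neg, integral_neg] at h
  exact self_eq_neg.1 h.symm

theorem integral_normSq_cscgOne {s : ℝ} (hs : 0 < s) : ∫ z, ‖z‖ ^ 2 ∂(cscgOne s) = s := by
  rw [integral_cscgOne hs]
  have h := Complex.integral_rpow_mul_exp_neg_mul_rpow (p := 2) (q := 2) (b := s⁻¹) (by norm_num)
    (by norm_num) (inv_pos.2 hs)
  -- Puts the argument of the Gamma function in the form that evaluates to `1!`.
  have h2 : (2 + 2 : ℝ) / 2 = (1 : ℕ) + 1 := by norm_num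
  rw [neg_div, h2, Real.Gamma_nat_eq_factorial, Real.rpow_neg (inv_pos.2 hs).le,
    Real.inv_rpow hs.le, inv_inv] at h
  have h3 : s ^ (((1 : ℕ) : ℝ) + 1) = s ^ 2 := by
    rw [← Real.rpow_natCast]; norm_num
  rw [h3] at h
  have h4 : ∀ z : ℂ, ((Real.pi * s)⁻¹ * Real.exp (-‖z‖ ^ 2 / s)) • ‖z‖ ^ 2 =
      (Real.pi * s)⁻¹ * (‖z‖ ^ (2 : ℝ) * Real.exp (-s⁻¹ * ‖z‖ ^ (2 : ℝ))) := by
    intro z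
    rw [Real.rpow_two, smul_eq_mul, mul_assoc, mul_comm (Real.exp _)]
    congr 3
    field_simp
  simp only [h4]
  rw [integral_const_mul, h]
  have := Real.pi_pos.ne'
  simp
  field_simp

theorem memLp_id_cscgOne {s : ℝ} (hs : 0 < s) : MemLp (fun z : ℂ => z) 2 (cscgOne s) := by
  rw [memLp_two_iff_integrable_sq_norm (f := fun z : ℂ => z) measurable_id.aestronglyMeasurable]
  -- A non-integrable function has integral `0` by convention, whereas the second moment is `s > 0`.
  by_contra h
  have h1 := integral_normSq_cscgOne hs
  rw [integral_undef h] at h1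
  exact hs.ne h1

variable {n : ℕ}

theorem isProbabilityMeasure_cscg (n : ℕ) {s : ℝ} (hs : 0 < s) :
    IsProbabilityMeasure (cscg n s) := by
  have := isProbabilityMeasure_cscgOne hs
  rw [cscg_eq_pi n hs]
  infer_instance

theorem memLp_cscg {s : ℝ} (hs : 0 < s) (i : Fin n) :
    MemLp (fun x : Fin n → ℂ => x i) 2 (cscg n s) := by
  have := isProbabilityMeasure_cscgOne hs
  rw [cscg_eq_pi n hs]
  exact (memLp_id_cscgOne hs).comp_measurePreserving
    (measurePreserving_eval (fun _ : Fin n => cscgOne s) i)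

theorem integral_cscg_eval {s : ℝ} (hs : 0 < s) (i : Fin n) {f : ℂ → ℂ} (hf : Continuous f) :
    ∫ x, f (x i) ∂(cscg n s) = ∫ z, f z ∂(cscgOne s) := by
  have := isProbabilityMeasure_cscgOne hs
  rw [cscg_eq_pi n hs]
  have hp := measurePreserving_eval (fun _ : Fin n => cscgOne s) i
  have h := integral_map (μ := Measure.pi fun _ : Fin n => cscgOne s) hp.measurable.aemeasurable
    (f := f) hf.aestronglyMeasurable
  rw [hp.map_eq] at h
  exact h.symm

theorem integral_cscg (s : ℝ) (hs : 0 < s) (i : Fin n) : ∫ x, x i ∂(cscg n s) = 0 := by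
  refine (integral_cscg_eval hs i continuous_id).trans ?_
  exact integral_id_cscgOne hs

theorem integral_cscg_mul_star {s : ℝ} (hs : 0 < s) (i j : Fin n) :
    ∫ x, x i * star (x j) ∂(cscg n s) = if i = j then (s : ℂ) else 0 := by
  split_ifs with h
  · subst h
    rw [integral_cscg_eval hs i (f := fun z => z * star z) (by fun_prop)]
    have h1 : ∀ z : ℂ, z * star z = ((‖z‖ ^ 2 : ℝ) : ℂ) := by
      intro z
      rw [RCLike.star_def, Complex.mul_conj']
      push_cast; rfl
    simp only [h1]
    rw [integral_complex_ofReal, integral_normSq_cscgOne hs]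
  · have := isProbabilityMeasure_cscgOne hs
    have hind : ProbabilityTheory.IndepFun (fun x : Fin n → ℂ => x i)
        (fun x : Fin n → ℂ => star (x j)) (cscg n s) := by
      rw [cscg_eq_pi n hs]
      have h0 := ProbabilityTheory.iIndepFun_pi (μ := fun _ : Fin n => cscgOne s)
        (X := fun _ z => z) (fun _ => measurable_id.aemeasurable)
      exact (h0.indepFun h).comp measurable_id continuous_star.measurable
    rw [hind.integral_fun_mul_eq_mul_integral
      (memLp_cscg hs i).1 (memLp_cscg hs j).1.star, integral_cscg s hs, zero_mul]

/-- Expectation of a sesquilinear form in two square-integrable random vectors. -/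
theorem integral_sesquilinear {Ω : Type*} [MeasurableSpace Ω] {μ : Measure Ω} {m k : ℕ}
    {a : Ω → Fin m → ℂ} {b : Ω → Fin k → ℂ} (ha : ∀ i, MemLp (fun ω => a ω i) 2 μ)
    (hb : ∀ i, MemLp (fun ω => b ω i) 2 μ) (Q : Matrix (Fin m) (Fin k) ℂ)
    {R : Matrix (Fin k) (Fin m) ℂ} (hR : ∀ i j, ∫ ω, b ω i * star (a ω j) ∂μ = R i j) :
    Integrable (fun ω => star (a ω) ⬝ᵥ (Q *ᵥ b ω)) μ ∧
      ∫ ω, star (a ω) ⬝ᵥ (Q *ᵥ b ω) ∂μ = (Q * R).trace := by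
  have h : ∀ ω, star (a ω) ⬝ᵥ (Q *ᵥ b ω) = ∑ i, ∑ j, Q i j * (b ω j * star (a ω i)) := by
    intro ω
    rw [dotProduct]
    refine Finset.sum_congr rfl fun i _ => ?_
    rw [Matrix.mulVec, dotProduct, Finset.mul_sum]
    refine Finset.sum_congr rfl fun j _ => ?_
    rw [Pi.star_apply]
    ring
  have hint : ∀ i j, Integrable (fun ω => Q i j * (b ω j * star (a ω i))) μ := fun i j =>
    ((hb j).integrable_mul (ha i).star).const_mul _
  simp only [h]
  refine ⟨integrable_finsetSum _ fun i _ => integrable_finsetSum _ fun j _ => hint i j, ?_⟩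
  rw [integral_finsetSum _ fun i _ => integrable_finsetSum _ fun j _ => hint i j, Matrix.trace]
  refine Finset.sum_congr rfl fun i _ => ?_
  rw [integral_finsetSum _ fun j _ => hint i j, Matrix.diag, Matrix.mul_apply]
  refine Finset.sum_congr rfl fun j _ => ?_
  rw [integral_const_mul, hR]

/-- Integrability makes both parts finite, so the extended difference is an honest real one. -/
theorem expect_coe {Ω : Type*} [MeasurableSpace Ω] {μ : Measure Ω} {f : Ω → ℝ}
    (hf : Integrable f μ) : expect μ (fun ω => (f ω : EReal)) = ((∫ ω, f ω ∂μ : ℝ) : EReal) := by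
  rw [expect, integral_eq_lintegral_pos_part_sub_lintegral_neg_part hf]
  have h1 : ∀ x : ℝ, (x : EReal).toENNReal = ENNReal.ofReal x := fun x => by
    simp [EReal.toENNReal]
  have h2 : ∀ x : ℝ, (-(x : EReal)).toENNReal = ENNReal.ofReal (-x) := fun x => by
    rw [← EReal.coe_neg, h1]
  simp only [h1, h2]
  have f1 : ∫⁻ ω, ENNReal.ofReal (f ω) ∂μ ≠ ⊤ := hf.lintegral_lt_top.ne
  have f2 : ∫⁻ ω, ENNReal.ofReal (-f ω) ∂μ ≠ ⊤ := hf.neg.lintegral_lt_top.ne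
  rw [EReal.coe_sub, EReal.coe_ennreal_toReal f1, EReal.coe_ennreal_toReal f2]

end Moments

/-! ### Closed form of the generalized mutual information -/

section Rate

variable {nR nT : ℕ}

theorem isProbabilityMeasure_inputNoiseLaw {N₀ : ℝ} (hN : 0 < N₀) :
    IsProbabilityMeasure (inputNoiseLaw nT nR N₀) := by
  have := isProbabilityMeasure_cscg nT one_pos
  have := isProbabilityMeasure_cscg nR hN
  rw [inputNoiseLaw]
  infer_instance

theorem memLp_input {N₀ : ℝ} (hN : 0 < N₀) (i : Fin nT) :
    MemLp (fun p : (Fin nT → ℂ) × (Fin nR → ℂ) => p.1 i) 2 (inputNoiseLaw nT nR N₀) := by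
  have := isProbabilityMeasure_cscg nT one_pos
  have := isProbabilityMeasure_cscg nR hN
  exact (memLp_cscg one_pos i).comp_measurePreserving measurePreserving_fst

theorem memLp_noise {N₀ : ℝ} (hN : 0 < N₀) (i : Fin nR) :
    MemLp (fun p : (Fin nT → ℂ) × (Fin nR → ℂ) => p.2 i) 2 (inputNoiseLaw nT nR N₀) := by
  have := isProbabilityMeasure_cscg nT one_pos
  have := isProbabilityMeasure_cscg nR hN
  exact (memLp_cscg hN i).comp_measurePreserving measurePreserving_snd

theorem integral_input_input {N₀ : ℝ} (hN : 0 < N₀) (i j : Fin nT) :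
    ∫ p, p.1 i * star (p.1 j) ∂(inputNoiseLaw nT nR N₀) =
      (1 : Matrix (Fin nT) (Fin nT) ℂ) i j := by
  have := isProbabilityMeasure_cscg nT one_pos
  have := isProbabilityMeasure_cscg nR hN
  rw [inputNoiseLaw, integral_fun_fst (fun x : Fin nT → ℂ => x i * star (x j)),
    integral_cscg_mul_star one_pos, Matrix.one_apply]
  simp

theorem integral_noise_noise {N₀ : ℝ} (hN : 0 < N₀) (i j : Fin nR) :
    ∫ p, p.2 i * star (p.2 j) ∂(inputNoiseLaw nT nR N₀) =
      ((N₀ : ℂ) • (1 : Matrix (Fin nR) (Fin nR) ℂ)) i j := by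
  have := isProbabilityMeasure_cscg nT one_pos
  have := isProbabilityMeasure_cscg nR hN
  rw [inputNoiseLaw, integral_fun_snd (fun x : Fin nR → ℂ => x i * star (x j)),
    integral_cscg_mul_star hN, Matrix.smul_apply, Matrix.one_apply]
  simp

theorem integral_noise_input {N₀ : ℝ} (hN : 0 < N₀) (i : Fin nR) (j : Fin nT) :
    ∫ p, p.2 i * star (p.1 j) ∂(inputNoiseLaw nT nR N₀) =
      (0 : Matrix (Fin nR) (Fin nT) ℂ) i j := by
  have := isProbabilityMeasure_cscg nT one_pos
  have := isProbabilityMeasure_cscg nR hN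
  simp only [mul_comm _ (star _)]
  rw [inputNoiseLaw, integral_prod_mul (fun x : Fin nT → ℂ => star (x j))
    (fun w : Fin nR → ℂ => w i), integral_cscg N₀ hN, mul_zero, Matrix.zero_apply]

theorem integral_input_noise {N₀ : ℝ} (hN : 0 < N₀) (i : Fin nT) (j : Fin nR) :
    ∫ p, p.1 i * star (p.2 j) ∂(inputNoiseLaw nT nR N₀) =
      (0 : Matrix (Fin nT) (Fin nR) ℂ) i j := by
  have := isProbabilityMeasure_cscg nT one_pos
  have := isProbabilityMeasure_cscg nR hN
  rw [inputNoiseLaw, integral_prod_mul (fun x : Fin nT → ℂ => x i)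
    (fun w : Fin nR → ℂ => star (w j)), integral_cscg 1 one_pos, zero_mul, Matrix.zero_apply]

theorem integral_received_quadratic (H : Matrix (Fin nR) (Fin nT) ℂ) {N₀ : ℝ} (hN : 0 < N₀)
    (Q : Matrix (Fin nR) (Fin nR) ℂ) :
    Integrable (fun p => star (received H p) ⬝ᵥ (Q *ᵥ received H p)) (inputNoiseLaw nT nR N₀) ∧
      ∫ p, star (received H p) ⬝ᵥ (Q *ᵥ received H p) ∂(inputNoiseLaw nT nR N₀) =
        (Q * (H * Hᴴ + (N₀ : ℂ) • 1)).trace := by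
  obtain ⟨i1, e1⟩ := integral_sesquilinear (memLp_input hN) (memLp_input hN) (Hᴴ * Q * H)
    (integral_input_input (nR := nR) hN)
  obtain ⟨i2, e2⟩ := integral_sesquilinear (memLp_input hN) (memLp_noise hN) (Hᴴ * Q)
    (integral_noise_input hN)
  obtain ⟨i3, e3⟩ := integral_sesquilinear (memLp_noise hN) (memLp_input hN) (Q * H)
    (integral_input_noise hN)
  obtain ⟨i4, e4⟩ := integral_sesquilinear (memLp_noise hN) (memLp_noise hN) Q
    (integral_noise_noise (nT := nT) hN)
  have h : ∀ p : (Fin nT → ℂ) × (Fin nR → ℂ), star (received H p) ⬝ᵥ (Q *ᵥ received H p) =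
      (star p.1 ⬝ᵥ ((Hᴴ * Q * H) *ᵥ p.1) + star p.1 ⬝ᵥ ((Hᴴ * Q) *ᵥ p.2)) +
      (star p.2 ⬝ᵥ ((Q * H) *ᵥ p.1) + star p.2 ⬝ᵥ (Q *ᵥ p.2)) := by
    intro p
    have hs : ∀ y, star (H *ᵥ p.1) ⬝ᵥ y = star p.1 ⬝ᵥ (Hᴴ *ᵥ y) := fun y => by
      rw [Matrix.star_mulVec, Matrix.dotProduct_mulVec]
    rw [received, star_add, add_dotProduct, hs, Matrix.mulVec_add, Matrix.mulVec_add,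
      dotProduct_add, dotProduct_add]
    simp only [Matrix.mulVec_mulVec, Matrix.mul_assoc]
  simp only [h]
  refine ⟨(i1.add i2).add (i3.add i4), ?_⟩
  rw [integral_add (i1.fun_add i2) (i3.fun_add i4), integral_add i1 i2, integral_add i3 i4, e1, e2, e3, e4,
    Matrix.mul_one, Matrix.mul_zero, Matrix.mul_zero, Matrix.trace_zero, Matrix.trace_zero,
    add_zero, zero_add, Matrix.mul_add, Matrix.trace_add, Matrix.mul_assoc,
    Matrix.trace_mul_comm, Matrix.mul_assoc]

theorem integral_input_received (H : Matrix (Fin nR) (Fin nT) ℂ) {N₀ : ℝ} (hN : 0 < N₀)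
    (Q : Matrix (Fin nT) (Fin nR) ℂ) :
    Integrable (fun p => star p.1 ⬝ᵥ (Q *ᵥ received H p)) (inputNoiseLaw nT nR N₀) ∧
      ∫ p, star p.1 ⬝ᵥ (Q *ᵥ received H p) ∂(inputNoiseLaw nT nR N₀) = (Q * H).trace := by
  obtain ⟨i1, e1⟩ := integral_sesquilinear (memLp_input hN) (memLp_input hN) (Q * H)
    (integral_input_input (nR := nR) hN)
  obtain ⟨i2, e2⟩ := integral_sesquilinear (memLp_input hN) (memLp_noise hN) Q
    (integral_noise_input hN)
  have h : ∀ p : (Fin nT → ℂ) × (Fin nR → ℂ), star p.1 ⬝ᵥ (Q *ᵥ received H p) =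
      star p.1 ⬝ᵥ ((Q * H) *ᵥ p.1) + star p.1 ⬝ᵥ (Q *ᵥ p.2) := by
    intro p
    rw [received, Matrix.mulVec_add, dotProduct_add, Matrix.mulVec_mulVec]
  simp only [h]
  refine ⟨i1.add i2, ?_⟩
  rw [integral_add i1 i2, e1, e2, Matrix.mul_one, Matrix.mul_zero, Matrix.trace_zero, add_zero]

theorem integral_re_eq {Ω : Type*} [MeasurableSpace Ω] {μ : Measure Ω} {f : Ω → ℂ}
    (hf : Integrable f μ) : ∫ ω, (f ω).re ∂μ = (∫ ω, f ω ∂μ).re := integral_re hf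

/-- Both logarithms are quadratic in `(x, y)`, so only `E[y yᴴ] = H Hᴴ + N₀`, `E[y xᴴ] = H` and `E[x
xᴴ] = 1` enter. -/
theorem GMI_of_posDef (H : Matrix (Fin nR) (Fin nT) ℂ) {N₀ : ℝ} (hN : 0 < N₀)
    (Hr : Matrix (Fin nT) (Fin nR) ℂ) {Gr : Matrix (Fin nT) (Fin nT) ℂ}
    (hM : (1 + Gr).PosDef) :
    GMI H N₀ Hr Gr = ((Real.log (1 + Gr).det.re
      - (Hrᴴ * (1 + Gr)⁻¹ * Hr * (H * Hᴴ + (N₀ : ℂ) • 1)).trace.re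
      + 2 * (Hr * H).trace.re - Gr.trace.re : ℝ) : EReal) := by
  have := isProbabilityMeasure_inputNoiseLaw (nT := nT) (nR := nR) hN
  obtain ⟨i1, e1⟩ := integral_received_quadratic H hN (Hrᴴ * (1 + Gr)⁻¹ * Hr)
  obtain ⟨i2, e2⟩ := integral_input_received H hN Hr
  obtain ⟨i3, e3⟩ := integral_sesquilinear (memLp_input hN) (memLp_input hN) Gr
    (integral_input_input (nR := nR) hN)
  have r1 := integral_re_eq i1
  have r2 := integral_re_eq i2
  have r3 := integral_re_eq i3
  have j1 : Integrable (fun p => (star (received H p) ⬝ᵥ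
      ((Hrᴴ * (1 + Gr)⁻¹ * Hr) *ᵥ received H p)).re) (inputNoiseLaw nT nR N₀) := i1.re
  have j2 : Integrable (fun p => (star p.1 ⬝ᵥ (Hr *ᵥ received H p)).re)
      (inputNoiseLaw nT nR N₀) := i2.re
  have j3 : Integrable (fun p => (star p.1 ⬝ᵥ (Gr *ᵥ p.1)).re) (inputNoiseLaw nT nR N₀) := i3.re
  rw [e1] at r1
  rw [e2] at r2
  rw [e3, Matrix.mul_one] at r3
  have h1 : ∀ p, ENNReal.log (receiverMarginal Hr Gr (received H p)) =
      ((-Real.log (1 + Gr).det.re + (star (received H p) ⬝ᵥ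
        ((Hrᴴ * (1 + Gr)⁻¹ * Hr) *ᵥ received H p)).re : ℝ) : EReal) := by
    intro p
    rw [log_receiverMarginal_of_posDef Hr hM, Matrix.star_mulVec, ← Matrix.dotProduct_mulVec,
      Matrix.mulVec_mulVec, Matrix.mulVec_mulVec, Matrix.mul_assoc]
  have h2 : ∀ p, ENNReal.log (ENNReal.ofReal (receiverFun Hr Gr (received H p) p.1)) =
      ((2 * (star p.1 ⬝ᵥ (Hr *ᵥ received H p)).re - (star p.1 ⬝ᵥ (Gr *ᵥ p.1)).re : ℝ) :
        EReal) := by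
    intro p
    rw [receiverFun, ENNReal.log_ofReal, if_neg (not_le.2 (Real.exp_pos _)), Real.log_exp]
  rw [GMI]
  simp only [h1, h2]
  have j4 : Integrable (fun p => 2 * (star p.1 ⬝ᵥ (Hr *ᵥ received H p)).re -
      (star p.1 ⬝ᵥ (Gr *ᵥ p.1)).re) (inputNoiseLaw nT nR N₀) := (j2.const_mul 2).sub j3
  rw [expect_coe ((integrable_const _).fun_add j1), expect_coe j4,
    integral_add (integrable_const _) j1, integral_sub (j2.const_mul 2) j3, integral_const_mul,
    r1, r2, r3, integral_const, probReal_univ, one_smul, ← EReal.coe_neg, ← EReal.coe_add]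
  congr 1
  ring

/-- The marginal is infinite for every `y`, and `⊥` absorbs the other expectation whatever its
value. Such `Gr` thus never beat a positive definite competitor. -/
theorem GMI_of_not_posDef (H : Matrix (Fin nR) (Fin nT) ℂ) {N₀ : ℝ} (hN : 0 < N₀)
    (Hr : Matrix (Fin nT) (Fin nR) ℂ) {Gr : Matrix (Fin nT) (Fin nT) ℂ} (hG : Gr.IsHermitian)
    (hM : ¬ (1 + Gr).PosDef) : GMI H N₀ Hr Gr = ⊥ := by
  have := isProbabilityMeasure_inputNoiseLaw (nT := nT) (nR := nR) hN
  rw [GMI]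
  simp only [log_receiverMarginal_of_not_posDef Hr hG hM]
  have : expect (inputNoiseLaw nT nR N₀) (fun _ => (⊤ : EReal)) = ⊤ := by
    simp [expect]
  rw [this, EReal.neg_top, EReal.bot_add]

end Rate

/-! ### Optimal front end and optimal banded matrix -/

section Optimization

variable {nR nT : ℕ}

/-- The covariance matrix of the received vector. -/
noncomputable def receivedCov (H : Matrix (Fin nR) (Fin nT) ℂ) (N₀ : ℝ) :
    Matrix (Fin nR) (Fin nR) ℂ :=
  H * Hᴴ + (N₀ : ℂ) • 1

theorem smul_one_posDef {m : ℕ} {N₀ : ℝ} (hN : 0 < N₀) :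
    ((N₀ : ℂ) • (1 : Matrix (Fin m) (Fin m) ℂ)).PosDef :=
  Matrix.PosDef.one.smul (Complex.zero_lt_real.2 hN)

theorem receivedCov_posDef (H : Matrix (Fin nR) (Fin nT) ℂ) {N₀ : ℝ} (hN : 0 < N₀) :
    (receivedCov H N₀).PosDef :=
  (smul_one_posDef hN).posSemidef_add (Matrix.posSemidef_self_mul_conjTranspose H)

/-- The matrix `I + Hᴴ H / N₀`. -/
noncomputable def gramPencil (H : Matrix (Fin nR) (Fin nT) ℂ) (N₀ : ℝ) :
    Matrix (Fin nT) (Fin nT) ℂ :=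
  1 + (N₀ : ℂ)⁻¹ • (Hᴴ * H)

theorem gramPencil_posDef (H : Matrix (Fin nR) (Fin nT) ℂ) {N₀ : ℝ} (hN : 0 < N₀) :
    (gramPencil H N₀).PosDef := by
  refine Matrix.PosDef.one.add_posSemidef
    ((Matrix.posSemidef_conjTranspose_mul_self H).smul ?_)
  rw [← Complex.ofReal_inv]
  exact Complex.zero_le_real.2 (inv_pos.2 hN).le

/-- Two expressions for the MMSE error covariance. -/
theorem gramPencil_inv (H : Matrix (Fin nR) (Fin nT) ℂ) {N₀ : ℝ} (hN : 0 < N₀) :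
    (gramPencil H N₀)⁻¹ = 1 - Hᴴ * (receivedCov H N₀)⁻¹ * H := by
  have hN' : (N₀ : ℂ) ≠ 0 := Complex.ofReal_ne_zero.2 hN.ne'
  have hR : IsUnit (receivedCov H N₀).det :=
    (Matrix.isUnit_iff_isUnit_det _).1 (receivedCov_posDef H hN).isUnit
  refine Matrix.inv_eq_right_inv ?_
  -- The push-through identity: both sides are `Hᴴ + N₀⁻¹ Hᴴ H Hᴴ`.
  have h1 : gramPencil H N₀ * Hᴴ = (N₀ : ℂ)⁻¹ • (Hᴴ * receivedCov H N₀) := by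
    rw [gramPencil, receivedCov, Matrix.add_mul, Matrix.mul_add, smul_add, Matrix.mul_smul,
      smul_smul, inv_mul_cancel₀ hN', one_smul, Matrix.mul_one, Matrix.one_mul, Matrix.smul_mul,
      Matrix.mul_assoc, add_comm]
  rw [Matrix.mul_sub, Matrix.mul_one, Matrix.mul_assoc, ← Matrix.mul_assoc (gramPencil H N₀), h1,
    Matrix.smul_mul, Matrix.mul_assoc, ← Matrix.mul_assoc (receivedCov H N₀),
    Matrix.mul_nonsing_inv _ hR, Matrix.one_mul, gramPencil, add_sub_cancel_right]

/-- The optimal front end for a given `Gr`. -/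
noncomputable def optimalFront (H : Matrix (Fin nR) (Fin nT) ℂ) (N₀ : ℝ)
    (Gr : Matrix (Fin nT) (Fin nT) ℂ) : Matrix (Fin nT) (Fin nR) ℂ :=
  (1 + Gr) * Hᴴ * (receivedCov H N₀)⁻¹

theorem trace_conjTranspose_re {m : ℕ} (A : Matrix (Fin m) (Fin m) ℂ) :
    Aᴴ.trace.re = A.trace.re := by
  rw [Matrix.trace_conjTranspose, RCLike.star_def, Complex.conj_re]

/-- Completing the square in the front end. -/
theorem front_complete_square (H : Matrix (Fin nR) (Fin nT) ℂ) {N₀ : ℝ} (hN : 0 < N₀)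
    {Gr : Matrix (Fin nT) (Fin nT) ℂ} (hM : (1 + Gr).PosDef) (E : Matrix (Fin nT) (Fin nR) ℂ) :
    -((optimalFront H N₀ Gr + E)ᴴ * (1 + Gr)⁻¹ * (optimalFront H N₀ Gr + E) *
        receivedCov H N₀).trace.re + 2 * ((optimalFront H N₀ Gr + E) * H).trace.re =
      (optimalFront H N₀ Gr * H).trace.re -
        (Eᴴ * (1 + Gr)⁻¹ * E * receivedCov H N₀).trace.re := by
  have hRp := receivedCov_posDef H hN
  set R := receivedCov H N₀
  set F := optimalFront H N₀ Gr with hF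
  have hR : IsUnit R.det := (Matrix.isUnit_iff_isUnit_det _).1 hRp.isUnit
  have hMu : IsUnit (1 + Gr).det := (Matrix.isUnit_iff_isUnit_det _).1 hM.isUnit
  -- The stationarity equation for `F`; with its adjoint `h2` it makes the cross terms cancel the
  -- part of the linear term coming from `E`.
  have h1 : (1 + Gr)⁻¹ * F * R = Hᴴ := by
    rw [hF, optimalFront, Matrix.mul_assoc, Matrix.mul_assoc, Matrix.nonsing_inv_mul _ hR,
      Matrix.mul_one, ← Matrix.mul_assoc, Matrix.nonsing_inv_mul _ hMu, Matrix.one_mul]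
  have h2 : R * Fᴴ * (1 + Gr)⁻¹ = H := by
    have := congrArg Matrix.conjTranspose h1
    rwa [Matrix.conjTranspose_mul, Matrix.conjTranspose_mul, hRp.1.eq, hM.1.inv.eq,
      Matrix.conjTranspose_conjTranspose, ← Matrix.mul_assoc] at this
  have t1 : (Fᴴ * (1 + Gr)⁻¹ * F * R).trace.re = (F * H).trace.re := by
    rw [Matrix.mul_assoc, Matrix.mul_assoc, ← Matrix.mul_assoc _ F R, h1,
      ← Matrix.conjTranspose_mul, trace_conjTranspose_re, Matrix.trace_mul_comm]
  have t2 : (Fᴴ * (1 + Gr)⁻¹ * E * R).trace.re = (E * H).trace.re := by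
    rw [Matrix.trace_mul_comm, ← Matrix.mul_assoc, ← Matrix.mul_assoc, h2, Matrix.trace_mul_comm]
  have t3 : (Eᴴ * (1 + Gr)⁻¹ * F * R).trace.re = (E * H).trace.re := by
    rw [Matrix.mul_assoc, Matrix.mul_assoc, ← Matrix.mul_assoc _ F R, h1,
      ← Matrix.conjTranspose_mul, trace_conjTranspose_re, Matrix.trace_mul_comm]
  simp only [Matrix.conjTranspose_add, Matrix.add_mul, Matrix.mul_add, Matrix.trace_add,
    Complex.add_re, t1, t2, t3]
  ring

/-- With `S = Eᴴ M⁻¹ E`, the trace splits as `tr (Hᴴ S H) + N₀ tr S`, two traces of positive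
semidefinite matrices. -/
theorem trace_form_nonneg (H : Matrix (Fin nR) (Fin nT) ℂ) {N₀ : ℝ} (hN : 0 < N₀)
    {M : Matrix (Fin nT) (Fin nT) ℂ} (hM : M.PosDef) (E : Matrix (Fin nT) (Fin nR) ℂ) :
    0 ≤ (Eᴴ * M⁻¹ * E * receivedCov H N₀).trace.re := by
  have hS : (Eᴴ * M⁻¹ * E).PosSemidef := hM.inv.posSemidef.conjTranspose_mul_mul_same E
  have h1 := Complex.nonneg_iff.1 hS.trace_nonneg
  have h2 := Complex.nonneg_iff.1 (hS.conjTranspose_mul_mul_same H).trace_nonneg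
  rw [receivedCov, Matrix.mul_add, Matrix.trace_add, ← Matrix.mul_assoc, Matrix.trace_mul_comm,
    ← Matrix.mul_assoc, Matrix.mul_smul, Matrix.mul_one, Matrix.trace_smul, Complex.add_re,
    smul_eq_mul, Complex.re_ofReal_mul]
  exact add_nonneg h2.1 (mul_nonneg hN.le h1.1)

theorem GMI_optimalFront (H : Matrix (Fin nR) (Fin nT) ℂ) {N₀ : ℝ} (hN : 0 < N₀)
    {Gr : Matrix (Fin nT) (Fin nT) ℂ} (hM : (1 + Gr).PosDef) :
    GMI H N₀ (optimalFront H N₀ Gr) Gr = ((Real.log (1 + Gr).det.re -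
      ((1 + Gr) * (gramPencil H N₀)⁻¹).trace.re + nT : ℝ) : EReal) := by
  have h := front_complete_square H hN hM 0
  simp only [add_zero, Matrix.mul_zero, Matrix.zero_mul, Matrix.trace_zero, Complex.zero_re,
    sub_zero] at h
  rw [GMI_of_posDef H hN _ hM]
  have h2 : ((1 + Gr) * (gramPencil H N₀)⁻¹).trace.re =
      nT + Gr.trace.re - (optimalFront H N₀ Gr * H).trace.re := by
    rw [gramPencil_inv H hN, Matrix.mul_sub, Matrix.mul_one, Matrix.trace_sub, Complex.sub_re,
      Matrix.trace_add, Complex.add_re, Matrix.trace_one, Fintype.card_fin, Complex.natCast_re,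
      optimalFront]
    simp only [Matrix.mul_assoc]
  congr 1
  rw [h2, ← receivedCov]
  linarith

theorem GMI_le_optimalFront (H : Matrix (Fin nR) (Fin nT) ℂ) {N₀ : ℝ} (hN : 0 < N₀)
    {Gr : Matrix (Fin nT) (Fin nT) ℂ} (hG : Gr.IsHermitian) (Hr : Matrix (Fin nT) (Fin nR) ℂ) :
    GMI H N₀ Hr Gr ≤ GMI H N₀ (optimalFront H N₀ Gr) Gr := by
  by_cases hM : (1 + Gr).PosDef
  · have h0 := front_complete_square H hN hM 0
    have h1 := front_complete_square H hN hM (Hr - optimalFront H N₀ Gr)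
    have h2 := trace_form_nonneg H hN hM (Hr - optimalFront H N₀ Gr)
    simp only [add_zero, Matrix.mul_zero, Matrix.zero_mul, Matrix.trace_zero, Complex.zero_re,
      sub_zero] at h0
    rw [add_sub_cancel] at h1
    rw [GMI_of_posDef H hN _ hM, GMI_of_posDef H hN _ hM, EReal.coe_le_coe_iff, ← receivedCov]
    linarith
  · rw [GMI_of_not_posDef H hN _ hG hM]
    exact bot_le

theorem one_add_mem_bandHermitian_iff {n K : ℕ} {M : Matrix (Fin n) (Fin n) ℂ} :
    1 + M ∈ bandHermitian n K ↔ M ∈ bandHermitian n K := by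
  have key : ∀ {A : Matrix (Fin n) (Fin n) ℂ} (i j : Fin n),
      ((i : ℕ) + K < j ∨ (j : ℕ) + K < i) → (1 + A) i j = A i j := by
    intro A i j hij
    have hne : i ≠ j := by rintro rfl; omega
    rw [Matrix.add_apply, Matrix.one_apply_ne hne, zero_add]
  constructor
  · rintro ⟨h1, h2⟩
    refine ⟨?_, fun i j hij => (key i j hij).symm.trans (h2 i j hij)⟩
    have := h1.sub Matrix.isHermitian_one
    rwa [add_sub_cancel_left] at this
  · rintro ⟨h1, h2⟩
    exact ⟨Matrix.isHermitian_one.add h1, fun i j hij => (key i j hij).trans (h2 i j hij)⟩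

theorem exists_gram_maximizer (H : Matrix (Fin nR) (Fin nT) ℂ) {N₀ : ℝ} (hN : 0 < N₀) (K : ℕ) :
    ∃ G₀ ∈ bandHermitian nT K,
      GMI H N₀ (optimalFront H N₀ G₀) G₀ =
        ((∑ i : Fin nT, (Real.log (minor (gramPencil H N₀)⁻¹ fun j => InWindow K i j ∧ j ≠ i) -
          Real.log (minor (gramPencil H N₀)⁻¹ (InWindow K i))) : ℝ) : EReal) ∧
      ∀ Gr ∈ bandHermitian nT K,
        GMI H N₀ (optimalFront H N₀ Gr) Gr ≤ GMI H N₀ (optimalFront H N₀ G₀) G₀ := by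
  obtain ⟨M₀, hb, hp, hv, hmax⟩ := exists_band_maximizer (gramPencil_posDef H hN).inv K
  have h1 : 1 + (M₀ - 1) = M₀ := add_sub_cancel 1 M₀
  have hp' : (1 + (M₀ - 1)).PosDef := by rwa [h1]
  refine ⟨M₀ - 1, one_add_mem_bandHermitian_iff.1 (by rwa [h1]), ?_, fun Gr hGr => ?_⟩
  · rw [GMI_optimalFront H hN hp', h1, hv]
  · by_cases hM : (1 + Gr).PosDef
    · rw [GMI_optimalFront H hN hM, GMI_optimalFront H hN hp', h1, EReal.coe_le_coe_iff]
      linarith [hmax _ (one_add_mem_bandHermitian_iff.2 hGr) hM]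
    · rw [GMI_of_not_posDef H hN _ hGr.1 hM]
      exact bot_le

theorem isOptimalReceiver_optimalFront (H : Matrix (Fin nR) (Fin nT) ℂ) {N₀ : ℝ} (hN : 0 < N₀)
    {K : ℕ} {G₀ : Matrix (Fin nT) (Fin nT) ℂ} (hG : G₀ ∈ bandHermitian nT K)
    (hmax : ∀ Gr ∈ bandHermitian nT K,
      GMI H N₀ (optimalFront H N₀ Gr) Gr ≤ GMI H N₀ (optimalFront H N₀ G₀) G₀) :
    IsOptimalReceiver H N₀ K (optimalFront H N₀) G₀ where
  front _ hGr := fun Hr _ => GMI_le_optimalFront H hN hGr.1 Hr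
  mem := hG
  gram := fun Gr hGr => hmax Gr hGr

/-- All optimal receivers attain the same rate. -/
theorem IsOptimalReceiver.GMI_eq {H : Matrix (Fin nR) (Fin nT) ℂ} {N₀ : ℝ} {K : ℕ}
    {F F' : Matrix (Fin nT) (Fin nT) ℂ → Matrix (Fin nT) (Fin nR) ℂ}
    {G G' : Matrix (Fin nT) (Fin nT) ℂ} (h : IsOptimalReceiver H N₀ K F G)
    (h' : IsOptimalReceiver H N₀ K F' G') : GMI H N₀ (F G) G = GMI H N₀ (F' G') G' := by
  have hle : ∀ {F F' : Matrix (Fin nT) (Fin nT) ℂ → Matrix (Fin nT) (Fin nR) ℂ}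
      {G G' : Matrix (Fin nT) (Fin nT) ℂ}, IsOptimalReceiver H N₀ K F G →
      IsOptimalReceiver H N₀ K F' G' → GMI H N₀ (F G) G ≤ GMI H N₀ (F' G') G' :=
    fun {F _ G _} h h' =>
      -- First `F' G` replaces `F G` at the same `G`, then `G'` replaces `G`.
      (h'.front G h.mem (Set.mem_univ (F G))).trans (h'.gram h.mem)
  exact le_antisymm (hle h h') (hle h' h)

end Optimization

/-! ### From window minors to the rate formula -/

section Formula

variable {nR nT : ℕ}

theorem minor_congr {n : ℕ} (B : Matrix (Fin n) (Fin n) ℂ) {p q : Fin n → Prop}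
    [DecidablePred p] [DecidablePred q] (h : ∀ j, p j ↔ q j) : minor B p = minor B q := by
  obtain rfl : p = q := funext fun j => propext (h j)
  congr!

theorem minor_of_forall {n : ℕ} (B : Matrix (Fin n) (Fin n) ℂ) {p : Fin n → Prop}
    [DecidablePred p] (h : ∀ j, p j) : minor B p = B.det.re := by
  rw [minor, ← Matrix.det_submatrix_equiv_self (Equiv.subtypeUnivEquiv h) B]
  rfl

theorem minor_of_forall_not {n : ℕ} (B : Matrix (Fin n) (Fin n) ℂ) {p : Fin n → Prop}
    [DecidablePred p] (h : ∀ j, ¬ p j) : minor B p = 1 := by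
  have : IsEmpty {j // p j} := ⟨fun j => h j.1 j.2⟩
  rw [minor, Matrix.det_isEmpty, Complex.one_re]

theorem minor_inv {n : ℕ} {A : Matrix (Fin n) (Fin n) ℂ} (hA : A.PosDef) (p : Fin n → Prop)
    [DecidablePred p] : A.det.re * minor A⁻¹ p = minor A fun j => ¬ p j := by
  have h := det_mul_det_inv_submatrix A ((Matrix.isUnit_iff_isUnit_det _).1 hA.isUnit) p
  rw [coe_minor hA.inv, (posDef_det_eq_re hA).1, ← Complex.ofReal_mul] at h
  rw [minor]
  have := congrArg Complex.re h
  rwa [Complex.ofReal_re] at this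

theorem logDetGram_removeCols (H : Matrix (Fin nR) (Fin nT) ℂ) (N₀ : ℝ) (k m : ℕ) :
    logDetGram (removeCols H k m) N₀ =
      Real.log (minor (gramPencil H N₀) fun j => ¬(k ≤ (j : ℕ) + 1 ∧ (j : ℕ) + 1 ≤ m)) := by
  rw [logDetGram, minor]
  congr 3
  ext i j
  simp [removeCols, gramPencil, Matrix.mul_apply, Matrix.one_apply, Subtype.ext_iff]

theorem logDetGram_eq (H : Matrix (Fin nR) (Fin nT) ℂ) (N₀ : ℝ) :
    logDetGram H N₀ = Real.log (gramPencil H N₀).det.re := rfl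

/-- Jacobi's identity in logarithmic form: the complementary minor of the pencil is the Gram
determinant with those columns removed. -/
theorem log_minor_inv (H : Matrix (Fin nR) (Fin nT) ℂ) {N₀ : ℝ} (hN : 0 < N₀) (k m : ℕ)
    {p : Fin nT → Prop} [DecidablePred p]
    (hp : ∀ j : Fin nT, p j ↔ (k ≤ (j : ℕ) + 1 ∧ (j : ℕ) + 1 ≤ m)) :
    Real.log (minor (gramPencil H N₀)⁻¹ p) =
      logDetGram (removeCols H k m) N₀ - logDetGram H N₀ := by
  have hA := gramPencil_posDef H hN
  have hd := (posDef_det_eq_re hA).2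
  have h := congrArg Real.log (minor_inv hA p)
  rw [Real.log_mul hd.ne' (minor_pos hA.inv _).ne'] at h
  rw [logDetGram_removeCols, logDetGram_eq,
    minor_congr (gramPencil H N₀) (fun j => not_congr (hp j).symm)]
  linarith

theorem logDetGram_removeCols_congr (H : Matrix (Fin nR) (Fin nT) ℂ) (N₀ : ℝ) {k m k' m' : ℕ}
    (h : ∀ j, j < nT → ((k ≤ j + 1 ∧ j + 1 ≤ m) ↔ (k' ≤ j + 1 ∧ j + 1 ≤ m'))) :
    logDetGram (removeCols H k m) N₀ = logDetGram (removeCols H k' m') N₀ := by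
  rw [logDetGram_removeCols, logDetGram_removeCols,
    minor_congr (gramPencil H N₀) (fun j => not_congr (h j j.2))]

theorem logDetGram_removeCols_of_none (H : Matrix (Fin nR) (Fin nT) ℂ) (N₀ : ℝ) {k m : ℕ}
    (h : ∀ j, j < nT → ¬(k ≤ j + 1 ∧ j + 1 ≤ m)) :
    logDetGram (removeCols H k m) N₀ = logDetGram H N₀ := by
  rw [logDetGram_removeCols, minor_of_forall _ (fun j => h j j.2), logDetGram_eq]

theorem logDetGram_removeCols_of_all (H : Matrix (Fin nR) (Fin nT) ℂ) (N₀ : ℝ) {k m : ℕ}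
    (h : ∀ j, j < nT → (k ≤ j + 1 ∧ j + 1 ≤ m)) :
    logDetGram (removeCols H k m) N₀ = 0 := by
  rw [logDetGram_removeCols, minor_of_forall_not _ (fun j => not_not.2 (h j j.2)), Real.log_one]

theorem sum_Icc_eq_sum_range (f : ℕ → ℝ) (a b : ℕ) :
    ∑ k ∈ Finset.Icc a b, f k = ∑ i ∈ Finset.range (b + 1 - a), f (a + i) := by
  rw [← Finset.sum_Ico_eq_sum_range]
  rfl

/-- Telescoping of window increments. -/
theorem sum_window_increments (g : ℕ → ℕ → ℝ) (c : ℝ) (n K : ℕ)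
    (hsat : ∀ k m, n ≤ m → g k m = g k n) (hall : g 1 n = 0) (hnone : g (n + 1) n = c) :
    ∑ i ∈ Finset.range n, (g (i + 2) (i + 1 + K) - g (i + 1) (i + 1 + K)) =
      c - ∑ k ∈ Finset.Icc 1 (n - K), g k (k + K)
        + ∑ k ∈ Finset.Icc 2 (n - K), g k (k + K - 1) := by
  -- If `n ≤ K`, every window reaches the last index and the whole sum telescopes.
  rcases le_or_gt n K with h | h
  · rw [Finset.Icc_eq_empty (by omega), Finset.Icc_eq_empty (by omega)]
    have : ∀ i ∈ Finset.range n, g (i + 2) (i + 1 + K) - g (i + 1) (i + 1 + K) =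
        g (i + 1 + 1) n - g (i + 1) n := fun i _ => by
      rw [hsat _ (i + 1 + K) (by omega), hsat _ (i + 1 + K) (by omega)]
    rw [Finset.sum_congr rfl this, Finset.sum_range_sub (fun i => g (i + 1) n), hnone, zero_add,
      hall]
    simp
  -- Exactly the first `e + 1` windows fit. The other `K` telescope to `c - g (e + 2) n`, which
  -- cancels the last positive term of the first group; hence the second sum has only `e` terms.
  · obtain ⟨e, rfl⟩ : ∃ e, n = e + 1 + K := ⟨n - K - 1, by omega⟩
    rw [Finset.sum_range_add, Nat.add_sub_cancel, sum_Icc_eq_sum_range, sum_Icc_eq_sum_range]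
    have : ∀ i ∈ Finset.range K,
        g (e + 1 + i + 2) (e + 1 + i + 1 + K) - g (e + 1 + i + 1) (e + 1 + i + 1 + K) =
        g (e + 1 + (i + 1) + 1) (e + 1 + K) - g (e + 1 + i + 1) (e + 1 + K) := fun i _ => by
      rw [hsat _ (e + 1 + i + 1 + K) (by omega), hsat _ (e + 1 + i + 1 + K) (by omega)]
      rfl
    rw [Finset.sum_congr rfl this, Finset.sum_range_sub (fun i => g (e + 1 + i + 1) (e + 1 + K)),
      hnone, Finset.sum_sub_distrib, Finset.sum_range_succ]
    have h1 : ∑ i ∈ Finset.range (e + 1 + 1 - 1), g (1 + i) (1 + i + K) =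
        ∑ i ∈ Finset.range (e + 1), g (i + 1) (i + 1 + K) := by
      refine Finset.sum_congr rfl fun i _ => by rw [add_comm 1 i]
    have h2 : ∑ i ∈ Finset.range (e + 1 + 1 - 2), g (2 + i) (2 + i + K - 1) =
        ∑ i ∈ Finset.range e, g (i + 2) (i + 1 + K) := by
      refine Finset.sum_congr rfl fun i _ => ?_
      congr 1 <;> omega
    rw [h1, h2]
    linarith [show g (e + 1 + 0 + 1) (e + 1 + K) = g (e + 2) (e + 1 + K) from rfl]

/-- Counted from `1`, the window of `i` starts at column `i + 1`, and at `i + 2` once `i` is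
dropped. The full log-determinants cancel in each difference. -/
theorem sum_log_minor (H : Matrix (Fin nR) (Fin nT) ℂ) {N₀ : ℝ} (hN : 0 < N₀) (K : ℕ) :
    ∑ i : Fin nT, (Real.log (minor (gramPencil H N₀)⁻¹ fun j => InWindow K i j ∧ j ≠ i) -
          Real.log (minor (gramPencil H N₀)⁻¹ (InWindow K i))) =
      logDetGram H N₀ - ∑ k ∈ Finset.Icc 1 (nT - K), logDetGram (removeCols H k (k + K)) N₀
        + ∑ k ∈ Finset.Icc 2 (nT - K), logDetGram (removeCols H k (k + K - 1)) N₀ := by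
  rw [← sum_window_increments (fun k m => logDetGram (removeCols H k m) N₀) (logDetGram H N₀) nT K
    (fun k m hm => logDetGram_removeCols_congr H N₀ fun j hj => by omega)
    (logDetGram_removeCols_of_all H N₀ fun j hj => by omega)
    (logDetGram_removeCols_of_none H N₀ fun j hj => by omega), ← Fin.sum_univ_eq_sum_range
    (fun i => logDetGram (removeCols H (i + 2) (i + 1 + K)) N₀ -
      logDetGram (removeCols H (i + 1) (i + 1 + K)) N₀)]
  refine Finset.sum_congr rfl fun i _ => ?_
  rw [log_minor_inv H hN (i + 2) (i + 1 + K), log_minor_inv H hN (i + 1) (i + 1 + K)]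
  · ring
  · intro j
    unfold InWindow
    omega
  · intro j
    have : j ≠ i ↔ (j : ℕ) ≠ i := not_congr Fin.ext_iff
    rw [this]
    unfold InWindow
    omega

theorem rate_formula_memoryless (H : Matrix (Fin nR) (Fin nT) ℂ) (N₀ : ℝ) :
    logDetGram H N₀ - ∑ k ∈ Finset.Icc 1 (nT - 0), logDetGram (removeCols H k (k + 0)) N₀
        + ∑ k ∈ Finset.Icc 2 (nT - 0), logDetGram (removeCols H k (k + 0 - 1)) N₀ =
      nT * logDetGram H N₀ - ∑ k ∈ Finset.Icc 1 nT, logDetGram (removeCols H k k) N₀ := by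
  have h : ∀ k ∈ Finset.Icc 2 nT,
      logDetGram (removeCols H k (k + 0 - 1)) N₀ = logDetGram H N₀ := fun k hk =>
    logDetGram_removeCols_of_none H N₀ fun j _ => by
      have := Finset.mem_Icc.1 hk
      omega
  simp only [Nat.sub_zero]
  rw [Finset.sum_congr rfl h, Finset.sum_const, Nat.card_Icc, nsmul_eq_mul]
  -- The second sum has `nT - 1` terms in truncated subtraction, so `nT = 0` is separate; there the
  -- log-determinant vanishes.
  rcases nT with _ | n
  · have : logDetGram H N₀ = 0 := by
      rw [logDetGram, Matrix.det_isEmpty, Complex.one_re, Real.log_one]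
    simp [this]
  · have : n + 1 + 1 - 2 = n := by omega
    rw [this]
    have h0 : ∀ k, logDetGram (removeCols H k (k + 0)) N₀ = logDetGram (removeCols H k k) N₀ :=
      fun _ => rfl
    simp only [h0]
    push_cast
    ring

end Formula

end ChannelShortening

theorem theorem2 (nR nT K : ℕ) (N₀ : ℝ) (hN₀ : 0 < N₀) (H : Matrix (Fin nR) (Fin nT) ℂ) :
    (∃ Hopt Gopt, ChannelShortening.IsOptimalReceiver H N₀ K Hopt Gopt) ∧
    ∀ Hopt Gopt, ChannelShortening.IsOptimalReceiver H N₀ K Hopt Gopt →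
      ChannelShortening.GMI H N₀ (Hopt Gopt) Gopt =
        ((ChannelShortening.logDetGram H N₀
          - ∑ k ∈ Finset.Icc 1 (nT - K),
              ChannelShortening.logDetGram (ChannelShortening.removeCols H k (k + K)) N₀
          + ∑ k ∈ Finset.Icc 2 (nT - K),
              ChannelShortening.logDetGram (ChannelShortening.removeCols H k (k + K - 1)) N₀ : ℝ) :
          EReal) ∧
      (K = 0 → ChannelShortening.GMI H N₀ (Hopt Gopt) Gopt =
        (((nT : ℝ) * ChannelShortening.logDetGram H N₀
          - ∑ k ∈ Finset.Icc 1 nT,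
              ChannelShortening.logDetGram (ChannelShortening.removeCols H k k) N₀ : ℝ) :
          EReal)) := by
  obtain ⟨G₀, hG₀, hval, hmax⟩ := ChannelShortening.exists_gram_maximizer H hN₀ K
  have hopt := ChannelShortening.isOptimalReceiver_optimalFront H hN₀ hG₀ hmax
  rw [ChannelShortening.sum_log_minor H hN₀ K] at hval
  refine ⟨⟨_, _, hopt⟩, fun Hopt Gopt h => ?_⟩
  have hgmi := (h.GMI_eq hopt).trans hval
  refine ⟨hgmi, ?_⟩
  rintro rfl
  rw [hgmi, ChannelShortening.rate_formula_memoryless]
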